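/- Let $G$ be a quantum network, i.e. a finite hypergraph with node set $V$ (the parties) and a set $E$ of nonempty hyperedges (the sources), and let $\rho$ be a state of a finite-dimensional system $\bigotimes_{v\in V}\mathcal H_v$. A $G$-state is a state $\bigotimes_{e\in E}\gamma_e$, where the source $e$ distributes an arbitrary state $\gamma_e$ (of arbitrary finite local dimensions) to the parties $v\in e$. Two different nodes are adjacent if some hyperedge contains both, and $\operatorname{dis}(u,v)$ is the resulting graph distance ($\infty$ if no path connects $u$ and $v$). Let $\mathcal S_{\rm C}(G)$ be the closure of the set of states obtained from $G$-states by local operations and shared randomness (LOSR), and let $$\mathcal E_w(\rho|G)=\min\{\,p:\ \rho\succeq(1-p)\sigma\ \text{for some}\ \sigma\in\mathcal S_{\rm C}(G)\,\}.$$ In a *round* of an LOCC protocol one party applies a local instrument and broadcasts classical information about its outcome to the other parties, which then apply local channels that may depend on it. A *step* is a finite sequence of consecutive rounds in which each party either sends or receives classical information, but not both, and classical information is only sent to adjacent parties. For a state $\tau$ let $r_c(\tau|G)$ (resp. $r_r(\tau|G)$) be the minimal number of steps (resp. rounds) with which an LOCC protocol, assisted by shared randomness, can prepare $\tau$ to arbitrary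 accuracy from $G$-states ($\infty$ if there is no such number; the value is $0$ iff $\tau\in\mathcal S_{\rm C}(G)$). The network communication cost $\mathcal E_c$ and the network round complexity $\mathcal E_r$ are $$\mathcal E_{c}(\rho|G)=\min\sum_i p_i\,r_{c}(\rho_i|G),\qquad \mathcal E_{r}(\rho|G)=\min\sum_i p_i\,r_{r}(\rho_i|G),$$ the minima being over all finite convex decompositions $\rho=\sum_i p_i\rho_i$ into states. Let $r_c(G)=\min_{e\in E}\max_{u\in V}\min_{v\in e}\operatorname{dis}(u,v)$ be the edge radius of $G$, and let the connected domination number $d_c(G)$ be the least number of nodes of a connected subnetwork of $G$ such that every node is in it or adjacent to a node in it (a minimum over the empty set is $\infty$; in particular both numbers are $\infty$ if $G$ is disconnected). Then, with the convention $\infty\cdot 0=0\cdot\infty=0$, $$\mathcal E_w(\rho|G)\le\mathcal E_c(\rho|G)\le r_c(G)\,\mathcal E_w(\rho|G) \quad\text{and}\quad \mathcal E_w(\rho|G)\le\mathcal E_r(\rho|G)\le d_c(G)\,\mathcal E_w(\rho|G).$$ -/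

import Mathlib

open scoped ENNReal NNReal Matrix ComplexOrder

noncomputable section

/-! ## Networks and their graph parameters -/

/-- A quantum network: a finite hypergraph on the set `V` of parties (nodes). Each hyperedge
stands for a source that distributes quantum systems to exactly the parties in it. -/
structure QNetwork (V : Type*) where
  edges : Finset (Finset V)
  edges_nonempty : ∀ e ∈ edges, e.Nonempty

/-- Two different parties are adjacent (neighbours) if they share a source. -/
def QNetwork.graph {V : Type*} (G : QNetwork V) : SimpleGraph V where
  Adj u v := u ≠ v ∧ ∃ e ∈ G.edges, u ∈ e ∧ v ∈ e
  symm := ⟨fun _ _ h => ⟨h.1.symm, h.2.imp fun _ he => ⟨he.1, he.2.2, he.2.1⟩⟩⟩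
  loopless := ⟨fun _ h => h.1 rfl⟩

/-- The edge radius `min_{e ∈ E} max_{u ∈ V} min_{v ∈ e} dis(u, v)`. The distance is `⊤` between
parties that no path connects, so the value is `⊤` if the network is disconnected. -/
def QNetwork.edgeRadius {V : Type*} (G : QNetwork V) : ℕ∞ :=
  ⨅ e ∈ G.edges, ⨆ u : V, ⨅ v ∈ e, G.graph.edist u v

/-- The connected domination number: the least number of nodes of a connected subnetwork such that
every node is in it or adjacent to a node in it (`⊤` if there is none, i.e. if the network is
disconnected). -/
def QNetwork.connDomNumber {V : Type*} (G : QNetwork V) : ℕ∞ :=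
  ⨅ (S : Finset V) (_ : (G.graph.induce (S : Set V)).Connected)
    (_ : ∀ u, u ∉ S → ∃ v ∈ S, G.graph.Adj u v), (S.card : ℕ∞)

/-! ## Multipartite states and local operations -/

/-- Density matrices (quantum states). -/
def IsDensity {ι : Type*} [Fintype ι] (ρ : Matrix ι ι ℂ) : Prop :=
  ρ.PosSemidef ∧ ρ.trace = 1

/-- The product operator `⨂_v K v`, where `K v` acts on the system of party `v`. -/
def tensorOp {V : Type*} [Fintype V] {a b : V → Type*} (K : ∀ v, Matrix (b v) (a v) ℂ) :
    Matrix (∀ v, b v) (∀ v, a v) ℂ :=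
  Matrix.of fun x y => ∏ v, K v (x v) (y v)

/-- `τ'` is the image of `τ` under a product `⨂_v C_v` of local channels, the channel `C_v` having
the Kraus operators `B v j`. -/
def IsLocalImage {V : Type*} [Fintype V] [DecidableEq V] {a b : V → Type*}
    [∀ v, Fintype (a v)] [∀ v, DecidableEq (a v)] [∀ v, Fintype (b v)]
    (τ : Matrix (∀ v, a v) (∀ v, a v) ℂ) (τ' : Matrix (∀ v, b v) (∀ v, b v) ℂ) : Prop :=
  ∃ (m : V → ℕ) (B : ∀ v, Fin (m v) → Matrix (b v) (a v) ℂ),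
    (∀ v, ∑ j, (B v j)ᴴ * B v j = 1) ∧
    τ' = ∑ j : (∀ v, Fin (m v)),
      tensorOp (fun v => B v (j v)) * τ * (tensorOp (fun v => B v (j v)))ᴴ

/-- `τ'` is the image of `τ` under one round of LOCC in which party `s` measures and sends the
outcome to the parties in `R`: party `s` applies an instrument with outcomes `i`, the completely
positive map of outcome `i` having the Kraus operators `B s i j`; every other party `u` applies a
local channel with Kraus operators `B u i j`, which may depend on the outcome `i` only if `u ∈ R`.
(Parties keep a record of outcomes and messages in their output systems.) -/
def IsActionImage {V : Type*} [Fintype V] [DecidableEq V] {a b : V → Type*}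
    [∀ v, Fintype (a v)] [∀ v, DecidableEq (a v)] [∀ v, Fintype (b v)]
    (s : V) (R : Set V)
    (τ : Matrix (∀ v, a v) (∀ v, a v) ℂ) (τ' : Matrix (∀ v, b v) (∀ v, b v) ℂ) : Prop :=
  ∃ (n : ℕ) (m : V → ℕ) (B : ∀ u, Fin n → Fin (m u) → Matrix (b u) (a u) ℂ),
    (∑ i, ∑ j, (B s i j)ᴴ * B s i j = 1) ∧
    (∀ u, u ≠ s → ∀ i, ∑ j, (B u i j)ᴴ * B u i j = 1) ∧
    (∀ u, u ≠ s → u ∉ R → ∀ i i', B u i = B u i') ∧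
    τ' = ∑ i, ∑ j : (∀ u, Fin (m u)),
      tensorOp (fun u => B u i (j u)) * τ * (tensorOp (fun u => B u i (j u)))ᴴ

/-- A choice of sources for the network: the source `e` emits the state `state e`, giving a system
with basis indexed by `sys e v` to each `v ∈ e` (`sys e v` is not used for `v ∉ e`). -/
structure QNetwork.Sources {V : Type*} [Fintype V] [DecidableEq V] (G : QNetwork V) where
  sys : Finset V → V → Type
  [fin : ∀ e v, Fintype (sys e v)]
  [dec : ∀ e v, DecidableEq (sys e v)]
  state : ∀ e : G.edges, Matrix (∀ v : e.1, sys e.1 v) (∀ v : e.1, sys e.1 v) ℂ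
  isDensity : ∀ e, IsDensity (state e)

attribute [instance] QNetwork.Sources.fin QNetwork.Sources.dec

/-- The total system of party `v`: one part from each source connected to `v`. -/
abbrev QNetwork.Sources.nodeSys {V : Type*} [Fintype V] [DecidableEq V] {G : QNetwork V}
    (γ : G.Sources) (v : V) : Type _ :=
  ∀ e : {e : Finset V // e ∈ G.edges ∧ v ∈ e}, γ.sys e.1 v

/-- The `G`-state `⨂_e γ_e`, as a state of the parties. -/
def QNetwork.Sources.netState {V : Type*} [Fintype V] [DecidableEq V] {G : QNetwork V}
    (γ : G.Sources) : Matrix (∀ v, γ.nodeSys v) (∀ v, γ.nodeSys v) ℂ :=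
  Matrix.of fun x y => ∏ e : G.edges,
    γ.state e (fun v => x v.1 ⟨e.1, e.2, v.2⟩) (fun v => y v.1 ⟨e.1, e.2, v.2⟩)

/-- A matrix on a multipartite system, together with the local systems of the parties. -/
structure MultiState (V : Type*) where
  sys : V → Type
  [fin : ∀ v, Fintype (sys v)]
  [dec : ∀ v, DecidableEq (sys v)]
  mat : Matrix (∀ v, sys v) (∀ v, sys v) ℂ

attribute [instance] MultiState.fin MultiState.dec

/-! ## Protocols -/

section Protocols

variable {V : Type*} [Fintype V] [DecidableEq V]

/-- A round: some party acts and broadcasts the outcome to all other parties. -/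
def IsRound (τ τ' : MultiState V) : Prop :=
  ∃ s : V, IsActionImage s Set.univ τ.mat τ'.mat

/-- A step: finitely many consecutive rounds in which information is sent only by parties in `S`
and received only by parties in `R`, where `S` and `R` are disjoint, and it is sent only to
neighbouring parties. -/
def QNetwork.IsStep (G : QNetwork V) (τ τ' : MultiState V) : Prop :=
  ∃ S R : Set V, Disjoint S R ∧
    Relation.ReflTransGen
      (fun σ σ' : MultiState V => ∃ s ∈ S, ∃ T ⊆ R, (∀ u ∈ T, G.graph.Adj s u) ∧
        IsActionImage s T σ.mat σ'.mat) τ τ'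

/-- The states obtained exactly, without shared randomness, from a `G`-state by local channels
followed by `k` transformations of the kind `next`. -/
def QNetwork.preparable (G : QNetwork V) (next : MultiState V → MultiState V → Prop) :
    ℕ → Set (MultiState V)
  | 0 => {τ | ∃ γ : G.Sources, IsLocalImage γ.netState τ.mat}
  | k + 1 => {τ' | ∃ τ ∈ G.preparable next k, next τ τ'}

variable {a : V → Type} [∀ v, Fintype (a v)] [∀ v, DecidableEq (a v)]

/-- The set `S_C(G)`: the closure of the set of states that can be prepared from `G`-states by LOSR,
`∑_λ p_λ (⨂_v C_v^λ) [⨂_e γ_e^λ]`. -/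
def QNetwork.freeStates (G : QNetwork V) (a : V → Type) [∀ v, Fintype (a v)] :
    Set (Matrix (∀ v, a v) (∀ v, a v) ℂ) :=
  closure (convexHull ℝ {σ | ∃ γ : G.Sources, IsLocalImage γ.netState σ})

/-- The states that can be prepared to arbitrary accuracy from `G`-states with `k` transformations
of the kind `next` and shared randomness (a mixture of such protocols). -/
def QNetwork.achievable (G : QNetwork V) (next : MultiState V → MultiState V → Prop) (k : ℕ) :
    Set (Matrix (∀ v, a v) (∀ v, a v) ℂ) :=
  closure (convexHull ℝ {σ | (⟨a, σ⟩ : MultiState V) ∈ G.preparable next k})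

/-- The minimal number of transformations of the kind `next` that are needed to prepare `ρ`
to arbitrary accuracy (`⊤` if no number suffices). -/
def QNetwork.cost (G : QNetwork V) (next : MultiState V → MultiState V → Prop)
    (ρ : Matrix (∀ v, a v) (∀ v, a v) ℂ) : ℕ∞ :=
  ⨅ (k : ℕ) (_ : ρ ∈ G.achievable next k), (k : ℕ∞)

/-- The minimum over all convex decompositions `ρ = ∑ p_i ρ_i` into states of the average
`∑ p_i r(ρ_i)`. -/
def convexRoof (r : Matrix (∀ v, a v) (∀ v, a v) ℂ → ℕ∞)
    (ρ : Matrix (∀ v, a v) (∀ v, a v) ℂ) : ℝ≥0∞ :=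
  ⨅ (N : ℕ) (p : Fin N → ℝ≥0) (σ : Fin N → Matrix (∀ v, a v) (∀ v, a v) ℂ)
    (_ : (∀ i, IsDensity (σ i)) ∧ ∑ i, p i = 1 ∧ ρ = ∑ i, (p i : ℝ) • σ i),
    ∑ i, (p i : ℝ≥0∞) * (r (σ i) : ℝ≥0∞)

/-- The network communication cost `E_c(ρ|G)`. -/
def QNetwork.commCost (G : QNetwork V) (ρ : Matrix (∀ v, a v) (∀ v, a v) ℂ) : ℝ≥0∞ :=
  convexRoof (G.cost G.IsStep) ρ

/-- The network round complexity `E_r(ρ|G)`. -/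
def QNetwork.roundComplexity (G : QNetwork V) (ρ : Matrix (∀ v, a v) (∀ v, a v) ℂ) : ℝ≥0∞ :=
  convexRoof (G.cost IsRound) ρ

/-- The network-entanglement weight `E_w(ρ|G)`: the least `p` such that `ρ ⪰ (1 - p) σ` for some
`σ ∈ S_C(G)`. -/
def QNetwork.weight (G : QNetwork V) (ρ : Matrix (∀ v, a v) (∀ v, a v) ℂ) : ℝ≥0∞ :=
  ⨅ (p : ℝ) (σ ∈ G.freeStates a) (_ : (ρ - (1 - p) • σ).PosSemidef), ENNReal.ofReal p

end Protocols

end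

noncomputable section

/-! ## Product operators and Kraus maps -/

section Kraus

open Matrix

variable {V : Type*} [Fintype V]

/-! Both chains of inequalities have the same skeleton. With zero transformations, exactly the
states in `freeStates` are achievable, so a free state costs 0 and any other state at least 1. In a
convex decomposition of `ρ` the free terms add up to `(1 - p) • σ` with `σ` free, where `p` is the
total weight of the other terms; hence the average cost is at least `p`, and `p` is at least the
weight (`weight_le_convexRoof`). Conversely, `ρ ⪰ (1 - p) σ` gives `ρ = (1 - p) σ + p τ` with a
state `τ`, so the average cost is at most `p` times any bound `R` on the costs of all states
(`convexRoof_cost_le`).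

It remains to bound the cost of an arbitrary state by the graph parameter, and this is done by
teleportation (`isActionImage_teleport`). A state is encoded in registers, one per party, which may
first sit anywhere and then hop along edges of the graph; each hop uses up a Bell pair emitted by a
source at the very beginning.

For steps (`cost_isStep_le`), the source `e` emits the encoded state, and step `t + 1` moves data
from the parties within distance `t` of `e` to parties beyond, so that senders and receivers are
disjoint.

For rounds (`cost_isRound_le`), one node of a connected dominating set prepares everything locally.
The set is enumerated so that each node is adjacent to an earlier one; each node in turn uses one
round to teleport data to its neighbours, and domination ensures that every party is served. -/

theorem tensorOp_mul [DecidableEq V] {a b c : V → Type*} [∀ v, Fintype (b v)]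
    (K : ∀ v, Matrix (c v) (b v) ℂ) (L : ∀ v, Matrix (b v) (a v) ℂ) :
    tensorOp K * tensorOp L = tensorOp fun v => K v * L v := by
  ext x y
  simp only [tensorOp, mul_apply, of_apply, Fintype.prod_sum, Finset.prod_mul_distrib]

theorem tensorOp_conjTranspose {a b : V → Type*} (K : ∀ v, Matrix (b v) (a v) ℂ) :
    (tensorOp K)ᴴ = tensorOp fun v => (K v)ᴴ := by
  ext x y
  simp [tensorOp, conjTranspose_apply, star_prod]

theorem tensorOp_one {a : V → Type*} [∀ v, DecidableEq (a v)] :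
    tensorOp (fun v => (1 : Matrix (a v) (a v) ℂ)) = 1 := by
  ext x y
  simp only [tensorOp, of_apply, one_apply, Finset.prod_ite_zero, Finset.prod_const_one,
    Finset.mem_univ, true_imp_iff, funext_iff]

theorem sum_tensorOp [DecidableEq V] {a b J : V → Type*} [∀ v, Fintype (J v)]
    (B : ∀ v, J v → Matrix (b v) (a v) ℂ) :
    ∑ j : (∀ v, J v), tensorOp (fun v => B v (j v)) = tensorOp fun v => ∑ j, B v j := by
  ext x y
  simp [tensorOp, Matrix.sum_apply, Fintype.prod_sum]

/-- The completely positive map whose Kraus operators are the products `⨂_v B v (j v)`. -/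
def krausMap [DecidableEq V] {a b J : V → Type*} [∀ v, Fintype (a v)] [∀ v, Fintype (J v)]
    (B : ∀ v, J v → Matrix (b v) (a v) ℂ) (τ : Matrix (∀ v, a v) (∀ v, a v) ℂ) :
    Matrix (∀ v, b v) (∀ v, b v) ℂ :=
  ∑ j : (∀ v, J v), tensorOp (fun v => B v (j v)) * τ * (tensorOp fun v => B v (j v))ᴴ

variable [DecidableEq V]

theorem krausMap_sum {a b J : V → Type*} [∀ v, Fintype (a v)] [∀ v, Fintype (J v)] {ι : Type*}
    (s : Finset ι) (B : ∀ v, J v → Matrix (b v) (a v) ℂ)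
    (τ : ι → Matrix (∀ v, a v) (∀ v, a v) ℂ) :
    krausMap B (∑ i ∈ s, τ i) = ∑ i ∈ s, krausMap B (τ i) := by
  simp only [krausMap, Matrix.mul_sum, Matrix.sum_mul]
  exact Finset.sum_comm

theorem krausMap_reindex {a b J J' : V → Type*} [∀ v, Fintype (a v)] [∀ v, Fintype (J v)]
    [∀ v, Fintype (J' v)] (e : ∀ v, J' v ≃ J v) (B : ∀ v, J v → Matrix (b v) (a v) ℂ)
    (τ : Matrix (∀ v, a v) (∀ v, a v) ℂ) :
    krausMap (fun v j => B v (e v j)) τ = krausMap B τ :=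
  Fintype.sum_equiv (Equiv.piCongrRight e) _ _ fun _ => rfl

theorem krausMap_krausMap {a b c J J' : V → Type*} [∀ v, Fintype (a v)] [∀ v, Fintype (b v)]
    [∀ v, Fintype (J v)] [∀ v, Fintype (J' v)] (B : ∀ v, J v → Matrix (b v) (a v) ℂ)
    (B' : ∀ v, J' v → Matrix (c v) (b v) ℂ) (τ : Matrix (∀ v, a v) (∀ v, a v) ℂ) :
    krausMap B' (krausMap B τ) =
      krausMap (J := fun v => J v × J' v) (fun v j => B' v j.2 * B v j.1) τ := by
  have h : krausMap (J := fun v => J v × J' v) (fun v j => B' v j.2 * B v j.1) τ =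
      ∑ p : (∀ v, J v) × (∀ v, J' v), tensorOp (fun v => B' v (p.2 v) * B v (p.1 v)) * τ *
        (tensorOp (fun v => B' v (p.2 v) * B v (p.1 v)))ᴴ :=
    Fintype.sum_equiv (Equiv.arrowProdEquivProdArrow V J J') _ _ fun _ => rfl
  rw [h, Fintype.sum_prod_type_right]
  simp only [krausMap, Matrix.mul_sum, Matrix.sum_mul, ← tensorOp_mul, conjTranspose_mul,
    Matrix.mul_assoc]

theorem sum_kraus_prod {a b c J J' : Type*} [Fintype b] [Fintype c] [Fintype J]
    [Fintype J'] [DecidableEq b] (B : J → Matrix b a ℂ) (B' : J' → Matrix c b ℂ)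
    (h : ∑ j, (B' j)ᴴ * B' j = 1) :
    ∑ j : J × J', (B' j.2 * B j.1)ᴴ * (B' j.2 * B j.1) = ∑ j, (B j)ᴴ * B j := by
  rw [Fintype.sum_prod_type]
  refine Finset.sum_congr rfl fun j _ => ?_
  have : ∀ k, (B' k * B j)ᴴ * (B' k * B j) = (B j)ᴴ * ((B' k)ᴴ * B' k) * B j := fun k => by
    simp only [conjTranspose_mul, Matrix.mul_assoc]
  simp only [this, ← Matrix.mul_sum, ← Matrix.sum_mul, h, Matrix.mul_one]

section images

variable {a b c : V → Type*} [∀ v, Fintype (a v)] [∀ v, DecidableEq (a v)] [∀ v, Fintype (b v)]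
  [∀ v, DecidableEq (b v)] [∀ v, Fintype (c v)]
  {τ : Matrix (∀ v, a v) (∀ v, a v) ℂ} {τ' : Matrix (∀ v, b v) (∀ v, b v) ℂ}
  {τ'' : Matrix (∀ v, c v) (∀ v, c v) ℂ}

theorem IsLocalImage.of_krausMap {J : V → Type*} [∀ v, Fintype (J v)]
    (B : ∀ v, J v → Matrix (c v) (a v) ℂ) (h : ∀ v, ∑ j, (B v j)ᴴ * B v j = 1)
    (hτ : τ'' = krausMap B τ) : IsLocalImage τ τ'' := by
  let e : ∀ v, Fin (Fintype.card (J v)) ≃ J v := fun v => (Fintype.equivFin (J v)).symm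
  refine ⟨fun v => Fintype.card (J v), fun v j => B v (e v j), fun v => ?_, ?_⟩
  · rw [← h v]
    exact Fintype.sum_equiv (e v) _ _ fun _ => rfl
  · rw [hτ, ← krausMap_reindex e]
    rfl

theorem IsActionImage.of_krausMap {s : V} {R : Set V} {I : Type*} [Fintype I] {J : V → Type*}
    [∀ v, Fintype (J v)] (B : I → ∀ v, J v → Matrix (c v) (a v) ℂ)
    (hs : ∑ i, ∑ j, (B i s j)ᴴ * B i s j = 1)
    (hu : ∀ u, u ≠ s → ∀ i, ∑ j, (B i u j)ᴴ * B i u j = 1)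
    (hR : ∀ u, u ≠ s → u ∉ R → ∀ i i', B i u = B i' u)
    (hτ : τ'' = ∑ i, krausMap (B i) τ) : IsActionImage s R τ τ'' := by
  let e : ∀ v, Fin (Fintype.card (J v)) ≃ J v := fun v => (Fintype.equivFin (J v)).symm
  let f : Fin (Fintype.card I) ≃ I := (Fintype.equivFin I).symm
  refine ⟨Fintype.card I, fun v => Fintype.card (J v), fun v i j => B (f i) v (e v j), ?_, ?_, ?_,
    ?_⟩
  · rw [← hs]
    exact Fintype.sum_equiv f _ _ fun i => Fintype.sum_equiv (e s) _ _ fun _ => rfl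
  · intro u hus i
    rw [← hu u hus (f i)]
    exact Fintype.sum_equiv (e u) _ _ fun _ => rfl
  · intro u hus huR i i'
    funext j
    exact congrFun (hR u hus huR (f i) (f i')) (e u j)
  · rw [hτ]
    refine (Fintype.sum_equiv f _ _ fun i => ?_).symm
    exact krausMap_reindex e (B (f i)) τ

theorem IsLocalImage.trans (h : IsLocalImage τ τ') (h' : IsLocalImage τ' τ'') :
    IsLocalImage τ τ'' := by
  obtain ⟨m, B, hB, rfl⟩ := h
  obtain ⟨m', B', hB', rfl⟩ := h'
  refine IsLocalImage.of_krausMap (J := fun v => Fin (m v) × Fin (m' v))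
    (fun v j => B' v j.2 * B v j.1) (fun v => ?_) (krausMap_krausMap B B' τ)
  rw [sum_kraus_prod _ _ (hB' v), hB v]

/-- The pairs of outcomes serve as the outcomes of a single instrument. This is what lets one party
perform any number of teleportations in one round. -/
theorem IsActionImage.trans {s : V} {R : Set V} (h : IsActionImage s R τ τ')
    (h' : IsActionImage s R τ' τ'') : IsActionImage s R τ τ'' := by
  obtain ⟨n, m, B, hs, hu, hR, rfl⟩ := h
  obtain ⟨n', m', B', hs', hu', hR', rfl⟩ := h'
  refine IsActionImage.of_krausMap (I := Fin n × Fin n') (J := fun v => Fin (m v) × Fin (m' v))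
    (fun i v j => B' v i.2 j.2 * B v i.1 j.1) ?_ (fun u hus i => ?_) (fun u hus huR i i' => ?_) ?_
  · have := sum_kraus_prod (J := Fin n × Fin (m s)) (J' := Fin n' × Fin (m' s))
      (fun p => B s p.1 p.2) (fun p => B' s p.1 p.2) (by rw [Fintype.sum_prod_type, hs'])
    rw [Fintype.sum_prod_type (f := fun p : Fin n × Fin (m s) => (B s p.1 p.2)ᴴ * B s p.1 p.2),
      hs] at this
    rw [← this]
    simp only [Fintype.sum_prod_type]
    refine Finset.sum_congr rfl fun i _ => ?_
    rw [Finset.sum_comm]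
  · rw [sum_kraus_prod _ _ (hu' u hus i.2), hu u hus i.1]
  · rw [hR u hus huR i.1 i'.1, hR' u hus huR i.2 i'.2]
  · have h1 : ∀ i', krausMap (fun u => B' u i') (∑ i, krausMap (fun u => B u i) τ) =
        ∑ i, krausMap (J := fun v => Fin (m v) × Fin (m' v))
          (fun v j => B' v i' j.2 * B v i j.1) τ := fun i' => by
      rw [krausMap_sum]
      exact Finset.sum_congr rfl fun i _ => krausMap_krausMap _ _ _
    rw [Fintype.sum_prod_type_right]
    exact Finset.sum_congr rfl fun i' _ => h1 i'

theorem IsLocalImage.isActionImage (s : V) (R : Set V) (h : IsLocalImage τ τ'') :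
    IsActionImage s R τ τ'' := by
  obtain ⟨m, B, hB, rfl⟩ := h
  exact IsActionImage.of_krausMap (I := Unit) (fun _ => B) (by simpa using hB s)
    (fun u _ _ => hB u) (fun _ _ _ _ _ => rfl) (by simp [krausMap])

theorem IsLocalImage.refl (τ : Matrix (∀ v, a v) (∀ v, a v) ℂ) : IsLocalImage τ τ :=
  IsLocalImage.of_krausMap (J := fun _ => Unit) (fun _ _ => 1) (by simp)
    (by simp [krausMap, tensorOp_one])

theorem IsActionImage.mono {s : V} {R R' : Set V} (hR : R ⊆ R') (h : IsActionImage s R τ τ'') :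
    IsActionImage s R' τ τ'' := by
  obtain ⟨n, m, B, h1, h2, h3, h4⟩ := h
  exact ⟨n, m, B, h1, h2, fun u hu hu' => h3 u hu fun h => hu' (hR h), h4⟩

end images

/-- The sum of `KᴴK` over the product Kraus operators factorizes into the local sums, all equal to
`1`. -/
theorem trace_krausMap {a b J : V → Type*} [∀ v, Fintype (a v)] [∀ v, DecidableEq (a v)]
    [∀ v, Fintype (b v)] [∀ v, Fintype (J v)] (B : ∀ v, J v → Matrix (b v) (a v) ℂ)
    (h : ∀ v, ∑ j, (B v j)ᴴ * B v j = 1) (τ : Matrix (∀ v, a v) (∀ v, a v) ℂ) :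
    (krausMap B τ).trace = τ.trace := by
  have h1 : ∑ j : (∀ v, J v), (tensorOp fun v => B v (j v))ᴴ * tensorOp (fun v => B v (j v)) =
      1 := by
    simp only [tensorOp_conjTranspose, tensorOp_mul]
    rw [sum_tensorOp (fun v j => (B v j)ᴴ * B v j)]
    simp only [h, tensorOp_one]
  rw [krausMap, trace_sum]
  simp only [Matrix.mul_assoc, trace_mul_comm (tensorOp _)]
  rw [← trace_sum]
  simp only [← Matrix.mul_sum, h1, Matrix.mul_one]

theorem posSemidef_krausMap {a b J : V → Type*} [∀ v, Fintype (a v)]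
    [∀ v, Fintype (b v)] [∀ v, Fintype (J v)] (B : ∀ v, J v → Matrix (b v) (a v) ℂ)
    {τ : Matrix (∀ v, a v) (∀ v, a v) ℂ} (hτ : τ.PosSemidef) :
    (krausMap B τ).PosSemidef :=
  Matrix.posSemidef_sum _ fun _ _ => hτ.mul_mul_conjTranspose_same _

theorem IsLocalImage.isDensity {a b : V → Type*} [∀ v, Fintype (a v)] [∀ v, DecidableEq (a v)]
    [∀ v, Fintype (b v)] {τ : Matrix (∀ v, a v) (∀ v, a v) ℂ}
    {τ' : Matrix (∀ v, b v) (∀ v, b v) ℂ} (h : IsLocalImage τ τ') (hτ : IsDensity τ) :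
    IsDensity τ' := by
  obtain ⟨m, B, hB, rfl⟩ := h
  exact ⟨posSemidef_krausMap B hτ.1, (trace_krausMap B hB τ).trans hτ.2⟩

end Kraus

/-! ## Tensor products of multipartite operators -/

section Tensor

open Matrix
open scoped Kronecker

variable {V : Type*}

/-- The tensor product of two multipartite operators, party by party. -/
def tens {A B : V → Type*} (M : Matrix (∀ v, A v) (∀ v, A v) ℂ)
    (N : Matrix (∀ v, B v) (∀ v, B v) ℂ) : Matrix (∀ v, A v × B v) (∀ v, A v × B v) ℂ :=
  Matrix.of fun x y =>
    M (fun v => (x v).1) (fun v => (y v).1) * N (fun v => (x v).2) (fun v => (y v).2)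

theorem tens_eq_submatrix {A B : V → Type*} (M : Matrix (∀ v, A v) (∀ v, A v) ℂ)
    (N : Matrix (∀ v, B v) (∀ v, B v) ℂ) :
    tens M N = (M ⊗ₖ N).submatrix (Equiv.arrowProdEquivProdArrow V A B)
      (Equiv.arrowProdEquivProdArrow V A B) := rfl

theorem tensorOp_kronecker [Fintype V] {a b a' b' : V → Type*} (K : ∀ v, Matrix (b v) (a v) ℂ)
    (L : ∀ v, Matrix (b' v) (a' v) ℂ) :
    tensorOp (fun v => K v ⊗ₖ L v) = (tensorOp K ⊗ₖ tensorOp L).submatrix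
      (Equiv.arrowProdEquivProdArrow V b b') (Equiv.arrowProdEquivProdArrow V a a') := by
  ext x y
  simp [tensorOp, kroneckerMap_apply, Finset.prod_mul_distrib, Equiv.arrowProdEquivProdArrow]

theorem krausMap_tens [Fintype V] [DecidableEq V] {a b a' b' J J' : V → Type*}
    [∀ v, Fintype (a v)] [∀ v, Fintype (a' v)] [∀ v, Fintype (J v)] [∀ v, Fintype (J' v)]
    (B : ∀ v, J v → Matrix (b v) (a v) ℂ)
    (B' : ∀ v, J' v → Matrix (b' v) (a' v) ℂ) (τ : Matrix (∀ v, a v) (∀ v, a v) ℂ)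
    (τ' : Matrix (∀ v, a' v) (∀ v, a' v) ℂ) :
    krausMap (J := fun v => J v × J' v) (fun v j => B v j.1 ⊗ₖ B' v j.2) (tens τ τ') =
      tens (krausMap B τ) (krausMap B' τ') := by
  have h : krausMap (J := fun v => J v × J' v) (fun v j => B v j.1 ⊗ₖ B' v j.2) (tens τ τ') =
      ∑ p : (∀ v, J v) × (∀ v, J' v), tensorOp (fun v => B v (p.1 v) ⊗ₖ B' v (p.2 v)) *
        tens τ τ' * (tensorOp (fun v => B v (p.1 v) ⊗ₖ B' v (p.2 v)))ᴴ :=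
    Fintype.sum_equiv (Equiv.arrowProdEquivProdArrow V J J') _ _ fun _ => rfl
  rw [h, Fintype.sum_prod_type]
  simp only [tensorOp_kronecker, tens_eq_submatrix, conjTranspose_submatrix,
    submatrix_mul_equiv, conjTranspose_kronecker, ← mul_kronecker_mul]
  ext x y
  simp only [krausMap, Matrix.sum_apply, submatrix_apply, kroneckerMap_apply, Finset.sum_mul_sum]

theorem IsLocalImage.tens [Fintype V] [DecidableEq V] {a b a' b' : V → Type*}
    [∀ v, Fintype (a v)] [∀ v, DecidableEq (a v)] [∀ v, Fintype (b v)]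
    [∀ v, Fintype (a' v)] [∀ v, DecidableEq (a' v)] [∀ v, Fintype (b' v)]
    {τ : Matrix (∀ v, a v) (∀ v, a v) ℂ} {σ : Matrix (∀ v, b v) (∀ v, b v) ℂ}
    {τ' : Matrix (∀ v, a' v) (∀ v, a' v) ℂ} {σ' : Matrix (∀ v, b' v) (∀ v, b' v) ℂ}
    (h : IsLocalImage τ σ) (h' : IsLocalImage τ' σ') :
    IsLocalImage (_root_.tens τ τ') (_root_.tens σ σ') := by
  obtain ⟨m, B, hB, rfl⟩ := h
  obtain ⟨m', B', hB', rfl⟩ := h'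
  refine IsLocalImage.of_krausMap (J := fun v => Fin (m v) × Fin (m' v))
    (fun v j => B v j.1 ⊗ₖ B' v j.2) (fun v => ?_) (krausMap_tens B B' τ τ').symm
  simp only [conjTranspose_kronecker, ← mul_kronecker_mul, Fintype.sum_prod_type]
  ext x y
  have h1 := congrFun₂ (hB v) x.1 y.1
  have h2 := congrFun₂ (hB' v) x.2 y.2
  simp only [Matrix.sum_apply] at h1 h2
  simp only [Matrix.sum_apply, kroneckerMap_apply, ← Finset.sum_mul_sum, h1, h2]
  rw [← one_kronecker_one, kroneckerMap_apply]

end Tensor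

/-! ## Push-forward of operators along functions, and local relabellings -/

section Push

open Matrix
open scoped Kronecker

/-- The matrix of the map of basis vectors `z ↦ E z`. -/
def mapMatrix {Z Y : Type*} [DecidableEq Y] (E : Z → Y) : Matrix Y Z ℂ :=
  (1 : Matrix Y Y ℂ).submatrix id E

/-- The push-forward of an operator along a map of basis vectors. -/
def push {Z Y : Type*} [Fintype Z] [DecidableEq Y] (E : Z → Y) (τ : Matrix Z Z ℂ) :
    Matrix Y Y ℂ :=
  mapMatrix E * τ * (mapMatrix E)ᴴ

theorem mul_mapMatrix {X Z Y : Type*} [Fintype Y] [DecidableEq Y] (E : Z → Y)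
    (T : Matrix X Y ℂ) : T * mapMatrix E = T.submatrix id E := by
  ext x z
  simp [mapMatrix, mul_apply, one_apply]

theorem mapMatrix_mul {Z Y U : Type*} [Fintype Y] [DecidableEq Y] [DecidableEq U] (F : Y → U)
    (E : Z → Y) : mapMatrix F * mapMatrix E = mapMatrix (F ∘ E) := by
  rw [mul_mapMatrix]
  rfl

theorem push_push {Z Y U : Type*} [Fintype Z] [Fintype Y] [DecidableEq Y] [DecidableEq U]
    (F : Y → U) (E : Z → Y) (τ : Matrix Z Z ℂ) : push F (push E τ) = push (F ∘ E) τ := by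
  simp only [push, ← mapMatrix_mul, conjTranspose_mul, Matrix.mul_assoc]

theorem push_apply {Z Y : Type*} [Fintype Z] [DecidableEq Y] (E : Z → Y) (τ : Matrix Z Z ℂ)
    (x y : Y) : push E τ x y = ∑ z, ∑ z', if x = E z ∧ y = E z' then τ z z' else 0 := by
  simp only [push, mapMatrix, mul_apply, conjTranspose_apply, submatrix_apply, id, one_apply,
    Finset.sum_mul]
  rw [Finset.sum_comm]
  refine Finset.sum_congr rfl fun z _ => Finset.sum_congr rfl fun z' _ => ?_
  by_cases h1 : x = E z <;> by_cases h2 : y = E z' <;> simp [h1, h2]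

theorem push_equiv {Z Y : Type*} [Fintype Z] [DecidableEq Z] [DecidableEq Y] (E : Z ≃ Y)
    (τ : Matrix Z Z ℂ) : push E τ = τ.submatrix E.symm E.symm := by
  ext x y
  simp only [push_apply, submatrix_apply, ite_and, ← Equiv.symm_apply_eq]
  simp

theorem push_id {Z : Type*} [Fintype Z] [DecidableEq Z] (τ : Matrix Z Z ℂ) : push id τ = τ :=
  push_equiv (Equiv.refl Z) τ

theorem IsDensity.push {Z Y : Type*} [Fintype Z] [Fintype Y] [DecidableEq Y] {E : Z → Y}
    (hE : Function.Injective E) {τ : Matrix Z Z ℂ} (hτ : IsDensity τ) :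
    IsDensity (_root_.push E τ) := by
  classical
  refine ⟨hτ.1.mul_mul_conjTranspose_same _, ?_⟩
  have h1 : (mapMatrix E)ᴴ * mapMatrix E = 1 := by
    rw [mul_mapMatrix]
    ext z z'
    simp [mapMatrix, one_apply, hE.eq_iff]
  rw [_root_.push, trace_mul_comm, ← Matrix.mul_assoc, h1, Matrix.one_mul, hτ.2]

variable {V : Type*} [Fintype V] [DecidableEq V]

/-- Party `v` applies the isometry `p ↦ (f v p, g v p)` and discards the second component. On the
support of the state that component has the fixed value `r₀ v`, so discarding it destroys no
coherence. -/
theorem isLocalImage_push {P Q R : V → Type*} [∀ v, Fintype (P v)] [∀ v, DecidableEq (P v)]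
    [∀ v, Fintype (Q v)] [∀ v, DecidableEq (Q v)] [∀ v, Fintype (R v)] [∀ v, DecidableEq (R v)]
    {Z : Type*} [Fintype Z] (f : ∀ v, P v → Q v) (g : ∀ v, P v → R v)
    (hfg : ∀ v p p', f v p = f v p' → g v p = g v p' → p = p')
    (E : Z → ∀ v, P v) (r₀ : ∀ v, R v) (hg : ∀ z v, g v (E z v) = r₀ v) (N : Matrix Z Z ℂ) :
    IsLocalImage (push E N) (push (fun z v => f v (E z v)) N) := by
  let K : ∀ v, R v → Matrix (Q v) (P v) ℂ := fun v r =>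
    Matrix.of fun q p => if q = f v p ∧ r = g v p then 1 else 0
  refine IsLocalImage.of_krausMap K (fun v => ?_) ?_
  · ext p p'
    simp only [K, Matrix.sum_apply, mul_apply, conjTranspose_apply, of_apply, one_apply, ite_and]
    simp only [apply_ite star, star_one, star_zero, ite_mul, one_mul, zero_mul]
    simp only [Finset.sum_ite_eq', Finset.mem_univ, if_true]
    by_cases h : p = p'
    · simp [h]
    · by_cases h1 : f v p = f v p' <;> by_cases h2 : g v p = g v p'
      · exact absurd (hfg v p p' h1 h2) h
      all_goals simp [h, h1, h2]
  · have key : ∀ r : (∀ v, R v), tensorOp (fun v => K v (r v)) * mapMatrix E =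
        if r = r₀ then mapMatrix (fun z v => f v (E z v)) else 0 := by
      intro r
      rw [mul_mapMatrix]
      ext x z
      simp only [tensorOp, K, submatrix_apply, of_apply, id, Finset.prod_ite_zero,
        Finset.prod_const_one, Finset.mem_univ, true_imp_iff, hg, forall_and]
      by_cases h : r = r₀
      · simp [h, mapMatrix, one_apply, funext_iff]
      · have : ¬ (∀ v, r v = r₀ v) := fun h' => h (funext h')
        simp [h, this]
    symm
    rw [krausMap]
    have h2 : ∀ r : (∀ v, R v), tensorOp (fun v => K v (r v)) * push E N *
        (tensorOp fun v => K v (r v))ᴴ = (tensorOp (fun v => K v (r v)) * mapMatrix E) * N *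
          (tensorOp (fun v => K v (r v)) * mapMatrix E)ᴴ := fun r => by
      simp only [push, conjTranspose_mul, Matrix.mul_assoc]
    simp only [h2, key]
    -- Of all values of the discarded systems only `r₀` occurs.
    rw [Finset.sum_eq_single r₀]
    · simp [push]
    · intro r _ hr
      simp [hr]
    · simp

theorem IsLocalImage.relabel {P Q : V → Type*} [∀ v, Fintype (P v)] [∀ v, DecidableEq (P v)]
    [∀ v, Fintype (Q v)] [∀ v, DecidableEq (Q v)] (q : ∀ v, P v ≃ Q v)
    (M : Matrix (∀ v, P v) (∀ v, P v) ℂ) :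
    IsLocalImage M (M.submatrix (Equiv.piCongrRight q).symm (Equiv.piCongrRight q).symm) := by
  have h := isLocalImage_push (R := fun _ => Unit) (fun v => q v) (fun _ _ => ())
    (fun v p p' h _ => (q v).injective h) id (fun _ => ()) (fun _ _ => rfl) M
  rw [push_id] at h
  rw [← push_equiv]
  exact h

theorem tens_push_push {V : Type*} [Fintype V] {A B : V → Type*}
    [∀ v, DecidableEq (A v)] [∀ v, DecidableEq (B v)] {Z Z' : Type*} [Fintype Z] [Fintype Z'] (E : Z → ∀ v, A v) (F : Z' → ∀ v, B v)
    (τ : Matrix Z Z ℂ) (N : Matrix Z' Z' ℂ) :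
    tens (push E τ) (push F N) = push (fun (p : Z × Z') v => (E p.1 v, F p.2 v)) (τ ⊗ₖ N) := by
  have h : mapMatrix (fun (p : Z × Z') v => (E p.1 v, F p.2 v)) =
      (mapMatrix E ⊗ₖ mapMatrix F).submatrix (Equiv.arrowProdEquivProdArrow V A B) id := by
    ext x p
    simp only [mapMatrix, submatrix_apply, kroneckerMap_apply, one_apply, id,
      Equiv.arrowProdEquivProdArrow, Equiv.coe_fn_mk, ← ite_and, mul_ite, mul_one, mul_zero]
    refine if_congr ?_ rfl rfl
    simp only [funext_iff, Prod.ext_iff, forall_and]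
    exact and_comm
  simp only [push]
  rw [h, conjTranspose_submatrix, conjTranspose_kronecker, tens_eq_submatrix, mul_kronecker_mul,
    mul_kronecker_mul]
  rfl

theorem tens_push {A B : V → Type*} [∀ v, DecidableEq (A v)]
    [∀ v, Fintype (B v)] [∀ v, DecidableEq (B v)] {Z : Type*} [Fintype Z] (E : Z → ∀ v, A v)
    (τ : Matrix Z Z ℂ) (N : Matrix (∀ v, B v) (∀ v, B v) ℂ) :
    tens (push E τ) N = push (fun (p : Z × (∀ v, B v)) v => (E p.1 v, p.2 v)) (τ ⊗ₖ N) := by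
  conv_lhs => rw [← push_id N]
  exact tens_push_push E id τ N

end Push

/-! ## Network states -/

section Sources

open Matrix
open scoped Kronecker MatrixOrder

variable {V : Type*} [Fintype V] [DecidableEq V] {G : QNetwork V}

theorem isDensity_one {ι : Type*} [Fintype ι] [DecidableEq ι] [Unique ι] :
    IsDensity (1 : Matrix ι ι ℂ) :=
  ⟨Matrix.PosSemidef.one, by simp⟩

theorem IsDensity.kronecker {ι κ : Type*} [Fintype ι] [Fintype κ] {M : Matrix ι ι ℂ}
    {N : Matrix κ κ ℂ} (hM : IsDensity M) (hN : IsDensity N) : IsDensity (M ⊗ₖ N) :=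
  ⟨hM.1.kronecker hN.1, by rw [trace_kronecker, hM.2, hN.2, one_mul]⟩

theorem IsDensity.submatrix_equiv {ι κ : Type*} [Fintype ι] [Fintype κ] {M : Matrix ι ι ℂ}
    (hM : IsDensity M) (e : κ ≃ ι) : IsDensity (M.submatrix e e) :=
  ⟨hM.1.submatrix e, by
    rw [← hM.2]
    exact Fintype.sum_equiv e _ _ fun _ => rfl⟩

/-- A tensor product of density matrices is a density matrix. -/
theorem isDensity_tensorOp {ι : Type*} [Fintype ι] [DecidableEq ι] {a : ι → Type*}
    [∀ i, Fintype (a i)] {M : ∀ i, Matrix (a i) (a i) ℂ} (hM : ∀ i, IsDensity (M i)) :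
    IsDensity (tensorOp M) := by
  classical
  constructor
  · choose C hC using fun i => (CStarAlgebra.nonneg_iff_eq_star_mul_self.mp (hM i).1.nonneg)
    have : M = fun i => (C i)ᴴ * C i := funext hC
    rw [this, ← tensorOp_mul, ← tensorOp_conjTranspose]
    exact posSemidef_conjTranspose_mul_self _
  · have : (tensorOp M).trace = ∏ i, (M i).trace := by
      simp only [trace, tensorOp, diag_apply, of_apply, Fintype.prod_sum]
    rw [this]
    exact Finset.prod_eq_one fun i _ => (hM i).2

/-- Grouping the systems of all sources by parties or by sources. -/
def QNetwork.Sources.regroup (γ : G.Sources) :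
    (∀ v, γ.nodeSys v) ≃ (∀ (e : G.edges) (v : e.1), γ.sys e.1 v) where
  toFun x e v := x v.1 ⟨e.1, e.2, v.2⟩
  invFun y v e := y ⟨e.1, e.2.1⟩ ⟨v, e.2.2⟩
  left_inv _ := rfl
  right_inv _ := rfl

theorem QNetwork.Sources.isDensity_netState (γ : G.Sources) : IsDensity γ.netState :=
  (isDensity_tensorOp γ.isDensity).submatrix_equiv γ.regroup

/-- Two families of sources used in parallel. -/
def QNetwork.Sources.prod (γ γ' : G.Sources) : G.Sources where
  sys e v := γ.sys e v × γ'.sys e v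
  state e := tens (γ.state e) (γ'.state e)
  isDensity e := ((γ.isDensity e).kronecker (γ'.isDensity e)).submatrix_equiv
    (Equiv.arrowProdEquivProdArrow _ _ _)

/-- Each party merely regroups its family of pairs into a pair of families. -/
theorem QNetwork.Sources.isLocalImage_prod (γ γ' : G.Sources) :
    IsLocalImage (γ.prod γ').netState (tens γ.netState γ'.netState) := by
  let q : ∀ v, (γ.prod γ').nodeSys v ≃ γ.nodeSys v × γ'.nodeSys v := fun v =>
    Equiv.arrowProdEquivProdArrow _ _ _
  let _ : ∀ v, DecidableEq (γ.nodeSys v × γ'.nodeSys v) := fun _ => instDecidableEqProd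
  have h := IsLocalImage.relabel q (γ.prod γ').netState
  convert h using 1
  ext x y
  simp only [tens, QNetwork.Sources.netState, of_apply, submatrix_apply,
    ← Finset.prod_mul_distrib]
  rfl

/-- Sources that emit one-dimensional systems only. -/
def QNetwork.Sources.trivial (G : QNetwork V) : G.Sources where
  sys _ _ := Unit
  state _ := 1
  isDensity _ := isDensity_one

instance (v : V) : Unique ((QNetwork.Sources.trivial G).nodeSys v) :=
  inferInstanceAs (Unique ({e : Finset V // e ∈ G.edges ∧ v ∈ e} → Unit))

/-- The states that local channels prepare from a network state. -/
def QNetwork.IsResource (G : QNetwork V) {A : V → Type*} [∀ v, Fintype (A v)]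
    (M : Matrix (∀ v, A v) (∀ v, A v) ℂ) : Prop :=
  ∃ γ : G.Sources, IsLocalImage γ.netState M

/-- Sources can be run in parallel, so all the Bell pairs of a protocol can be supplied at its
beginning. -/
theorem QNetwork.IsResource.tens {A B : V → Type*} [∀ v, Fintype (A v)] [∀ v, Fintype (B v)]
    [∀ v, DecidableEq (A v)] [∀ v, DecidableEq (B v)]
    {M : Matrix (∀ v, A v) (∀ v, A v) ℂ} {N : Matrix (∀ v, B v) (∀ v, B v) ℂ}
    (hM : G.IsResource M) (hN : G.IsResource N) : G.IsResource (_root_.tens M N) := by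
  obtain ⟨γ, hγ⟩ := hM
  obtain ⟨γ', hγ'⟩ := hN
  let _ : ∀ v, DecidableEq (γ.nodeSys v × γ'.nodeSys v) := fun _ => instDecidableEqProd
  exact ⟨γ.prod γ', (γ.isLocalImage_prod γ').trans (hγ.tens hγ')⟩

theorem QNetwork.IsResource.of_isLocalImage {A B : V → Type*} [∀ v, Fintype (A v)]
    [∀ v, DecidableEq (A v)] [∀ v, Fintype (B v)]
    {M : Matrix (∀ v, A v) (∀ v, A v) ℂ} {N : Matrix (∀ v, B v) (∀ v, B v) ℂ}
    (hM : G.IsResource M) (h : IsLocalImage M N) : G.IsResource N :=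
  hM.imp fun _ hγ => hγ.trans h

theorem QNetwork.IsResource.isDensity {A : V → Type*} [∀ v, Fintype (A v)]
    {M : Matrix (∀ v, A v) (∀ v, A v) ℂ} (hM : G.IsResource M) : IsDensity M := by
  obtain ⟨γ, hγ⟩ := hM
  exact hγ.isDensity γ.isDensity_netState

theorem QNetwork.isResource_unit (G : QNetwork V) :
    G.IsResource (1 : Matrix (V → Unit) (V → Unit) ℂ) := by
  refine ⟨.trivial G, ?_⟩
  have h := IsLocalImage.relabel (fun v => Equiv.ofUnique ((Sources.trivial G).nodeSys v) Unit)
    (Sources.trivial G).netState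
  convert h using 1
  ext x y
  simp only [one_apply, eq_iff_true_of_subsingleton, if_true, submatrix_apply]
  exact (Finset.prod_eq_one fun f _ => if_pos rfl).symm

theorem QNetwork.exists_isResource (G : QNetwork V) (A : V → Type*) [∀ v, Fintype (A v)]
    [∀ v, DecidableEq (A v)] [∀ v, Nonempty (A v)] :
    ∃ M : Matrix (∀ v, A v) (∀ v, A v) ℂ, G.IsResource M := by
  have x₀ : ∀ v, A v := fun v => Classical.arbitrary _
  refine ⟨_, G.isResource_unit.of_isLocalImage (IsLocalImage.of_krausMap (J := fun _ => Unit)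
    (fun v _ => Matrix.of fun x _ => if x = x₀ v then 1 else 0) (fun v => ?_) rfl)⟩
  ext x y
  simp [mul_apply, one_apply]

/-- A source can distribute any state to its parties, the other parties holding `x₀`. -/
theorem QNetwork.isResource_push {X : Type} [Fintype X] [DecidableEq X] {Z : Type*} [Fintype Z]
    {e : Finset V} (he : e ∈ G.edges) (x₀ : X) {E : Z → V → X} (hE : Function.Injective E)
    (hx₀ : ∀ z, ∀ v ∉ e, E z v = x₀) {τ : Matrix Z Z ℂ} (hτ : IsDensity τ) :
    G.IsResource (push E τ) := by
  let E' : Z → e → X := fun z v => E z v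
  have hE' : Function.Injective E' := fun z z' h => hE <| funext fun v => by
    by_cases hv : v ∈ e
    · exact congrFun h ⟨v, hv⟩
    · rw [hx₀ z v hv, hx₀ z' v hv]
  -- The sources other than `e` emit the fixed product vector with all entries `x₀`.
  let st : ∀ f : G.edges, Matrix (f.1 → X) (f.1 → X) ℂ := fun f =>
    if f.1 = e then push (fun z v => E z v) τ else push (fun (_ : Unit) _ => x₀) 1
  have hst : ∀ f, IsDensity (st f) := by
    rintro ⟨f, hf⟩
    by_cases h : f = e
    · subst h
      simp only [st, if_true]
      exact hτ.push hE'
    · simp only [st, h, if_false]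
      exact isDensity_one.push (Function.injective_of_subsingleton _)
  let γ : G.Sources := { sys := fun _ _ => X, state := st, isDensity := hst }
  refine ⟨γ, ?_⟩
  let E₀ : Z → ∀ v, γ.nodeSys v := fun z v f => if f.1 = e then E z v else x₀
  have hγ : γ.netState = push E₀ τ := by
    ext x y
    rw [push_apply]
    have h1 : ∀ f : G.edges, f ≠ ⟨e, he⟩ → st f (fun v => x v.1 ⟨f.1, f.2, v.2⟩)
        (fun v => y v.1 ⟨f.1, f.2, v.2⟩) = if (∀ v : f.1, x v.1 ⟨f.1, f.2, v.2⟩ = x₀ ∧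
          y v.1 ⟨f.1, f.2, v.2⟩ = x₀) then 1 else 0 := by
      intro f hf
      have : f.1 ≠ e := fun h => hf (Subtype.ext h)
      simp only [st, this, if_false, push_apply]
      simp [funext_iff, forall_and]
    have h2 : st ⟨e, he⟩ = push (fun z v => E z v.1) τ := if_pos rfl
    change ∏ f : G.edges, st f (fun v => x v.1 ⟨f.1, f.2, v.2⟩)
      (fun v => y v.1 ⟨f.1, f.2, v.2⟩) = _
    have h3 := Finset.prod_congr (rfl : Finset.univ.erase (⟨e, he⟩ : G.edges) = _)
      fun f hf => h1 f (Finset.ne_of_mem_erase hf)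
    rw [← Finset.mul_prod_erase _ _ (Finset.mem_univ (⟨e, he⟩ : G.edges)), h3, h2, push_apply,
      Finset.prod_ite_zero, Finset.prod_const_one, Finset.sum_mul]
    clear h1 h2 h3
    refine Finset.sum_congr rfl fun z _ => ?_
    rw [Finset.sum_mul]
    refine Finset.sum_congr rfl fun z' _ => ?_
    rw [mul_ite, mul_one, mul_zero, ← ite_and]
    have hiff : x = E₀ z ∧ y = E₀ z' ↔ (∀ f ∈ Finset.univ.erase (⟨e, he⟩ : G.edges), ∀ v : f.1,
        x v.1 ⟨f.1, f.2, v.2⟩ = x₀ ∧ y v.1 ⟨f.1, f.2, v.2⟩ = x₀) ∧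
        ((fun v : e => x v.1 ⟨e, he, v.2⟩) = fun v : e => E z v.1) ∧
        (fun v : e => y v.1 ⟨e, he, v.2⟩) = fun v : e => E z' v.1 := by
      simp only [funext_iff, Finset.mem_erase, Finset.mem_univ, and_true, E₀]
      constructor
      · rintro ⟨h4, h5⟩
        refine ⟨fun f hf v => ?_, fun v => ?_, fun v => ?_⟩
        · have : f.1 ≠ e := fun h => hf (Subtype.ext h)
          exact ⟨by simpa [this] using h4 v.1 ⟨f.1, f.2, v.2⟩,
            by simpa [this] using h5 v.1 ⟨f.1, f.2, v.2⟩⟩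
        · simpa using h4 v.1 ⟨e, he, v.2⟩
        · simpa using h5 v.1 ⟨e, he, v.2⟩
      · rintro ⟨h3, h4, h5⟩
        constructor <;> rintro v ⟨f, hf, hv⟩ <;> by_cases hfe : f = e
        · subst hfe
          simpa using h4 ⟨v, hv⟩
        · simpa [hfe] using (h3 ⟨f, hf⟩ (by simpa using hfe) ⟨v, hv⟩).1
        · subst hfe
          simpa using h5 ⟨v, hv⟩
        · simpa [hfe] using (h3 ⟨f, hf⟩ (by simpa using hfe) ⟨v, hv⟩).2
    by_cases hc : x = E₀ z ∧ y = E₀ z'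
    · rw [if_pos hc, if_pos (hiff.mp hc)]
    · rw [if_neg hc, if_neg fun h => hc (hiff.mpr h)]
  rw [hγ]
  -- `f` keeps the part that comes from `e`; `g` is everything else, which is constantly `x₀` on the
  -- support and can be discarded.
  let f : ∀ v, γ.nodeSys v → X := fun v x => if h : v ∈ e then x ⟨e, he, h⟩ else x₀
  let g : ∀ v, γ.nodeSys v → γ.nodeSys v := fun v x d => if d.1 = e then x₀ else x d
  have hf : E = fun z v => f v (E₀ z v) := by
    funext z v
    by_cases h : v ∈ e
    · simp [f, E₀, h]
    · simp [f, h, hx₀ z v h]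
  rw [hf]
  refine isLocalImage_push f g (fun v p p' hp hp' => ?_) E₀ (fun v _ => x₀) (fun z v => ?_) τ
  · funext d
    by_cases hd : d.1 = e
    · obtain ⟨d, h1, h2⟩ := d
      subst hd
      simpa [f, h2] using hp
    · simpa [g, hd] using congrFun hp' d
  · funext d
    by_cases hd : d.1 = e <;> simp [g, E₀, hd]

/-- Every state of a single party is prepared locally, the other parties holding `x₀`. -/
theorem QNetwork.isResource_push_single (G : QNetwork V) {X : Type*} [Fintype X] [DecidableEq X]
    (s : V) (x₀ : X) {τ : Matrix X X ℂ} (hτ : IsDensity τ) :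
    G.IsResource (push (fun (z : X) (v : V) => if v = s then z else x₀) τ) := by
  obtain ⟨C, hC⟩ := CStarAlgebra.nonneg_iff_eq_star_mul_self.mp hτ.1.nonneg
  have hC' : τ = Cᴴ * C := hC
  -- With `τ = Cᴴ * C`, the conjugated rows of `C` are vectors whose projectors sum to `τ`; `s`
  -- prepares these. All parties share the Kraus index type `X`, so the others use the operator of
  -- index `x₀` and zero otherwise.
  let K : V → X → Matrix X Unit ℂ := fun v j => Matrix.of fun x _ =>
    if v = s then star (C j x) else if j = x₀ ∧ x = x₀ then 1 else 0
  refine G.isResource_unit.of_isLocalImage (IsLocalImage.of_krausMap K (fun v => ?_) ?_)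
  · ext ⟨⟩ ⟨⟩
    by_cases hv : v = s
    · have : ∑ j, ∑ x, C j x * star (C j x) = 1 := by
        rw [← hτ.2, hC', trace, Finset.sum_comm]
        simp [mul_apply, mul_comm]
      simpa [K, hv, mul_apply, Matrix.sum_apply] using this
    · simp [K, hv, mul_apply, Matrix.sum_apply, ite_and]
  · let E : X → V → X := fun z v => if v = s then z else x₀
    let c : X → Matrix X (V → Unit) ℂ := fun k => Matrix.of fun x _ => star (C k x)
    have hK : ∀ (j : V → X) (x : V → X) (u : V → Unit), tensorOp (fun v => K v (j v)) x u =
        if ∀ v, v ≠ s → j v = x₀ ∧ x v = x₀ then star (C (j s) (x s)) else 0 := by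
      intro j x u
      rw [tensorOp, of_apply, ← Finset.mul_prod_erase _ _ (Finset.mem_univ s)]
      have : ∀ v ∈ Finset.univ.erase s, K v (j v) (x v) (u v) =
          if j v = x₀ ∧ x v = x₀ then 1 else 0 := fun v hv => by
        simp [K, Finset.ne_of_mem_erase hv]
      rw [Finset.prod_congr rfl this, Finset.prod_ite_zero]
      simp [K]
    have hE : Function.Injective E := fun z z' h => by simpa [E] using congrFun h s
    have h1 : ∀ k, tensorOp (fun v => K v (E k v)) = mapMatrix E * c k := by
      intro k
      ext x u
      rw [hK, mul_apply]
      simp only [mapMatrix, submatrix_apply, one_apply, id, c, of_apply, ite_mul, one_mul,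
        zero_mul]
      by_cases h : x = E (x s)
      · have h2 : ∀ z, x = E z ↔ z = x s := fun z =>
          ⟨fun hz => by simpa [E] using (congrFun hz s).symm, fun hz => hz ▸ h⟩
        simp only [h2, Finset.sum_ite_eq', Finset.mem_univ, if_true]
        rw [if_pos]
        · simp [E]
        · intro v hv
          have := congrFun h v
          simp_all [E]
      · rw [if_neg, Finset.sum_eq_zero]
        · intro z _
          rw [if_neg]
          rintro rfl
          exact h (by simp [E])
        · intro h2
          refine h (funext fun v => ?_)
          by_cases hv : v = s
          · simp [E, hv]
          · simp [E, hv, (h2 v hv).2]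
    have h2 : ∀ j : V → X, j ∉ Set.range E → tensorOp (fun v => K v (j v)) = 0 := by
      intro j hj
      ext x u
      rw [hK, if_neg, Matrix.zero_apply]
      intro h
      refine hj ⟨j s, funext fun v => ?_⟩
      by_cases hv : v = s
      · simp [E, hv]
      · simp [E, hv, (h v hv).1]
    have h3 : ∑ k, c k * (c k)ᴴ = τ := by
      ext x y
      simp [hC', c, Matrix.sum_apply, mul_apply]
    change push E τ = _
    rw [krausMap, ← Fintype.sum_of_injective E hE (fun k => mapMatrix E * (c k * (c k)ᴴ) *
      (mapMatrix E)ᴴ), ← Matrix.sum_mul, ← Matrix.mul_sum, h3, push]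
    · intro j hj
      rw [h2 j hj, Matrix.zero_mul, Matrix.zero_mul]
    · intro k
      rw [h1, Matrix.mul_one, conjTranspose_mul]
      simp only [Matrix.mul_assoc]

end Sources

/-! ## Teleportation -/

section Teleport

open Matrix
open scoped Kronecker

variable {D : Type*} [AddCommGroup D]

/-- The generalized Pauli operator `χ(q) δ(q = t + b)` of the character `χ` and the shift `b`. -/
def pauli [DecidableEq D] (i : AddChar D ℂ × D) (q t : D) : ℂ :=
  if q = t + i.2 then i.1 q else 0

theorem AddChar.mul_star_self [Finite D] (χ : AddChar D ℂ) (q : D) : χ q * star (χ q) = 1 := by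
  rw [Complex.star_def, Complex.mul_conj']
  simp

variable [Fintype D] [DecidableEq D]

/-- The rows of a Pauli operator are orthonormal: the correction by the receiver undoes the operator
that the Bell measurement leaves behind. -/
theorem sum_pauli_mul_star (i : AddChar D ℂ × D) (q p : D) :
    ∑ t, star (pauli i q t) * pauli i p t = if q = p then 1 else 0 := by
  have h : ∀ t, star (pauli i q t) * pauli i p t =
      if t = q - i.2 then (if q = p then 1 else 0) else 0 := by
    intro t
    by_cases h1 : q = t + i.2
    · have h1' : t = q - i.2 := by rw [h1, add_sub_cancel_right]
      by_cases h2 : q = p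
      · subst h2
        rw [if_pos h1', if_pos rfl, pauli, if_pos h1, mul_comm, AddChar.mul_star_self]
      · have h3 : ¬ p = t + i.2 := fun h => h2 (h1.trans h.symm)
        simp [pauli, h2, h3]
    · have h1' : ¬ t = q - i.2 := fun h => h1 (by rw [h, sub_add_cancel])
      simp [pauli, h1, h1']
  rw [Finset.sum_congr rfl fun _ _ => h _]
  simp

/-- The columns are orthonormal as well, which makes the correction a channel. -/
theorem sum_star_pauli_mul (i : AddChar D ℂ × D) (t t' : D) :
    ∑ q, star (pauli i q t) * pauli i q t' = if t = t' then 1 else 0 := by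
  have h : ∀ q, star (pauli i q t) * pauli i q t' =
      if q = t + i.2 then (if t = t' then 1 else 0) else 0 := by
    intro q
    by_cases h1 : q = t + i.2
    · by_cases h2 : t = t'
      · subst h2
        rw [if_pos h1, if_pos rfl, pauli, if_pos h1, mul_comm, AddChar.mul_star_self]
      · have h3 : ¬ q = t' + i.2 := fun h => h2 (add_right_cancel (h1.symm.trans h))
        simp [pauli, h2, h3]
    · simp [pauli, h1]
  rw [Finset.sum_congr rfl fun _ _ => h _]
  simp

/-- Summing over characters forces `q = q'`, and the common shift then forces `t = t'`. This is the
completeness of the Bell measurement. -/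
theorem sum_pauli (q t q' t' : D) :
    ∑ i : AddChar D ℂ × D, pauli i q t * star (pauli i q' t') =
      if q = q' ∧ t = t' then (Fintype.card D : ℂ) else 0 := by
  rw [Fintype.sum_prod_type_right]
  have h : ∀ b : D, ∑ χ : AddChar D ℂ, pauli (χ, b) q t * star (pauli (χ, b) q' t') =
      if b = q - t then (if q = q' ∧ t = t' then (Fintype.card D : ℂ) else 0) else 0 := by
    intro b
    by_cases h1 : q = t + b
    · have h1' : b = q - t := by rw [h1, add_sub_cancel_left]
      by_cases h2 : q' = t' + b
      · have h3 : ∀ χ : AddChar D ℂ, χ q * star (χ q') = χ (q - q') := fun χ => by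
          rw [sub_eq_add_neg, AddChar.map_add_eq_mul, AddChar.map_neg_eq_conj, Complex.star_def]
        simp only [pauli, if_pos h1, if_pos h2, h3, AddChar.sum_apply_eq_ite, if_pos h1']
        refine if_congr ?_ rfl rfl
        rw [sub_eq_zero]
        refine ⟨fun h => ⟨h, ?_⟩, And.left⟩
        rw [h1, h2] at h
        exact add_right_cancel h
      · have h3 : ¬ (q = q' ∧ t = t') := by
          rintro ⟨rfl, rfl⟩
          exact h2 h1
        simp [pauli, h2, h3]
    · have h1' : ¬ b = q - t := fun h => h1 (by rw [h, add_sub_cancel])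
      simp [pauli, h1, h1']
  rw [Finset.sum_congr rfl fun _ _ => h _]
  simp

/-- The amplitude `1 / √d` of a maximally entangled state of local dimension `d`. -/
def bellAmp (D : Type*) [Fintype D] : ℂ := ((√(Fintype.card D))⁻¹ : ℝ)

theorem bellAmp_mul_self {D : Type*} [AddCommGroup D] [Fintype D] :
    bellAmp D * bellAmp D * Fintype.card D = 1 := by
  have h : (0 : ℝ) < Fintype.card D := by exact_mod_cast Fintype.card_pos
  rw [bellAmp, ← Complex.ofReal_mul, ← mul_inv, Real.mul_self_sqrt h.le]
  push_cast
  exact inv_mul_cancel₀ (by exact_mod_cast h.ne')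

theorem star_bellAmp (D : Type*) [Fintype D] : star (bellAmp D) = bellAmp D :=
  Complex.conj_ofReal _

/-- An entry of `∑ j, (B j)ᴴ * B j` for Kraus operators that map the basis vector `y` to `α y` times
the basis vector `ξ y`, the environment being left in `κ y`. All operators used by teleportation are
built on this pattern. -/
theorem sum_star_ite_mul_ite {J X Y : Type*} [Fintype J] [Fintype X] [DecidableEq J]
    [DecidableEq X] (κ : Y → J) (ξ : Y → X) (α : Y → ℂ) (y y' : Y) :
    ∑ j, ∑ x, star (if j = κ y ∧ x = ξ y then α y else 0) *
      (if j = κ y' ∧ x = ξ y' then α y' else 0) =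
      if κ y = κ y' ∧ ξ y = ξ y' then star (α y) * α y' else 0 := by
  simp only [ite_and, apply_ite star, star_zero, ite_mul, zero_mul]
  rw [Finset.sum_eq_single (κ y) (fun j _ hj => by simp [hj]) (by simp)]
  rw [Finset.sum_eq_single (ξ y) (fun x _ hx => by simp [hx]) (by simp)]
  simp only [if_true]
  split_ifs <;> simp

variable {V : Type*}

/-- A maximally entangled state of the parties `s` and `u`; the other parties hold `0`. -/
def bellState [DecidableEq V] (D : Type*) [AddCommGroup D] [Fintype D] [DecidableEq D]
    [Fintype V] (s u : V) : Matrix (V → D) (V → D) ℂ :=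
  push (fun (t : D) v => if v = s ∨ v = u then t else 0)
    (Matrix.of fun _ _ => bellAmp D * bellAmp D)

variable [Fintype V] [DecidableEq V]

theorem isDensity_bellMatrix {D : Type*} [AddCommGroup D] [Fintype D] :
    IsDensity (Matrix.of fun _ _ => bellAmp D * bellAmp D : Matrix D D ℂ) := by
  constructor
  · have : (Matrix.of fun _ _ => bellAmp D * bellAmp D : Matrix D D ℂ) =
        (Matrix.of fun (_ : Unit) (_ : D) => bellAmp D)ᴴ * Matrix.of fun _ _ => bellAmp D := by
      ext x y
      change _ = ∑ _ : Unit, star (bellAmp D) * bellAmp D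
      simp only [star_bellAmp]
      simp
    rw [this]
    exact posSemidef_conjTranspose_mul_self _
  · rw [trace, ← bellAmp_mul_self (D := D)]
    simp [mul_comm]

theorem QNetwork.isResource_bellState {G : QNetwork V} {D : Type} [AddCommGroup D] [Fintype D]
    [DecidableEq D] {s u : V} (h : G.graph.Adj s u) : G.IsResource (bellState D s u) := by
  obtain ⟨-, e, he, hs, hu⟩ := h
  refine G.isResource_push he 0 (fun t t' h => ?_) (fun t v hv => ?_) isDensity_bellMatrix
  · simpa using congrFun h s
  · rw [if_neg]
    rintro (rfl | rfl) <;> exact hv ‹_›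

/-- Teleportation of the first register of `s` to the first register of `u`. -/
theorem isActionImage_teleport {P : V → Type*} [∀ v, Fintype (P v)] [∀ v, DecidableEq (P v)]
    {Z : Type*} [Fintype Z] {s u : V} (hsu : s ≠ u) (E : Z → ∀ v, D × P v)
    (hE : ∀ z, (E z u).1 = 0) (N : Matrix Z Z ℂ) :
    IsActionImage s {u} (tens (push E N) (bellState D s u))
      (push (fun z v => if v = s then (0, (E z v).2) else
        if v = u then ((E z s).1, (E z v).2) else E z v) N) := by
  classical
  set E' : Z → ∀ v, D × P v := fun z v => if v = s then (0, (E z v).2) else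
        if v = u then ((E z s).1, (E z v).2) else E z v with hE'
  have hE2 : ∀ z v, (E' z v).2 = (E z v).2 := fun z v => by
    simp only [hE']
    split_ifs <;> rfl
  -- On outcome `i`, `s` projects its first register and its half of the Bell pair onto a Bell
  -- vector and resets the register to `0`; `u` discards its old register and writes the
  -- Pauli-corrected half of the pair there; every other party discards its part of the pair.
  let B : AddChar D ℂ × D → ∀ v, D → Matrix (D × P v) ((D × P v) × D) ℂ := fun i v j =>
    Matrix.of fun x y =>
      if v = s then (if j = 0 ∧ x = (0, y.1.2) then bellAmp D * star (pauli i y.1.1 y.2) else 0)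
      else if v = u then (if j = y.1.1 ∧ x.2 = y.1.2 then pauli i x.1 y.2 else 0)
      else (if j = y.2 ∧ x = y.1 then 1 else 0)
  let F : Z × D → ∀ v, (D × P v) × D := fun p v => (E p.1 v, if v = s ∨ v = u then p.2 else 0)
  -- `L` adjoins the Bell vector, so that Kraus operators can be compared on the basis vectors `z`.
  let L : Matrix (Z × D) Z ℂ := Matrix.of fun p z => if p.1 = z then bellAmp D else 0
  have hst : tens (push E N) (bellState D s u) =
      (mapMatrix F * L) * N * (mapMatrix F * L)ᴴ := by
    rw [bellState, tens_push_push, push]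
    have : (N ⊗ₖ Matrix.of fun _ _ : D => bellAmp D * bellAmp D) = L * N * Lᴴ := by
      ext p q
      simp only [L, kroneckerMap_apply, of_apply, mul_apply, conjTranspose_apply, ite_mul,
        zero_mul, apply_ite star, star_zero, star_bellAmp, Finset.sum_ite_eq, Finset.mem_univ,
        if_true, mul_ite, mul_zero]
      ring
    rw [this, conjTranspose_mul]
    simp only [Matrix.mul_assoc]
    rfl
  -- Every outcome yields the same vectors, with amplitude `1 / d`; the environment always ends in
  -- `0`.
  have key : ∀ i (j : V → D), tensorOp (fun v => B i v (j v)) * (mapMatrix F * L) =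
      if j = 0 then (bellAmp D * bellAmp D) • mapMatrix E' else 0 := by
    intro i j
    rw [← Matrix.mul_assoc, mul_mapMatrix]
    ext x z
    have h1 : ∀ t, tensorOp (fun v => B i v (j v)) x (F (z, t)) =
        if ∀ v, j v = 0 ∧ (x v).2 = (E z v).2 ∧
          (v ≠ u → (x v).1 = if v = s then 0 else (E z v).1)
        then bellAmp D * (star (pauli i (E z s).1 t) * pauli i (x u).1 t) else 0 := by
      intro t
      have h2 : ∀ v, B i v (j v) (x v) (F (z, t) v) = if j v = 0 ∧ (x v).2 = (E z v).2 ∧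
          (v ≠ u → (x v).1 = if v = s then 0 else (E z v).1) then
          (if v = s then bellAmp D * star (pauli i (E z s).1 t) else 1) *
            (if v = u then pauli i (x u).1 t else 1) else 0 := by
        intro v
        by_cases hs : v = s
        · subst hs
          simp [B, F, hsu, Prod.ext_iff, and_comm]
        · by_cases hu : v = u
          · subst hu
            simp [B, F, hs, hE]
          · simp [B, F, hs, hu, Prod.ext_iff, and_comm]
      rw [tensorOp, of_apply]
      simp only [h2]
      rw [Finset.prod_ite_zero, Finset.prod_mul_distrib]
      simp [mul_assoc]
    have h3 : ∑ t, tensorOp (fun v => B i v (j v)) x (F (z, t)) =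
        if j = 0 ∧ x = E' z then bellAmp D else 0 := by
      simp only [h1]
      have h4 : (j = 0 ∧ x = E' z) ↔ ((∀ v, j v = 0 ∧ (x v).2 = (E z v).2 ∧
          (v ≠ u → (x v).1 = if v = s then 0 else (E z v).1)) ∧ (E z s).1 = (x u).1) := by
        constructor
        · rintro ⟨rfl, rfl⟩
          refine ⟨fun v => ⟨rfl, hE2 z v, fun hu => ?_⟩, ?_⟩
          · by_cases hs : v = s <;> simp [hE', hs, hu]
          · simp [hE', hsu.symm]
        · rintro ⟨h5, h6⟩
          refine ⟨funext fun v => (h5 v).1, funext fun v => Prod.ext ?_ ?_⟩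
          · by_cases hu : v = u
            · subst hu
              simp [hE', hsu.symm, h6]
            · rw [(h5 v).2.2 hu]
              by_cases hs : v = s <;> simp [hE', hs, hu]
          · rw [(h5 v).2.1, hE2]
      by_cases h5 : ∀ v, j v = 0 ∧ (x v).2 = (E z v).2 ∧
          (v ≠ u → (x v).1 = if v = s then 0 else (E z v).1)
      · simp only [if_pos h5, ← Finset.mul_sum, sum_pauli_mul_star, mul_ite, mul_one, mul_zero]
        exact if_congr (by rw [h4]; exact (and_iff_right h5).symm) rfl rfl
      · simp only [if_neg h5, Finset.sum_const_zero]
        rw [if_neg fun h => h5 (h4.mp h).1]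
    rw [mul_apply, Fintype.sum_prod_type]
    simp only [L, of_apply, mul_ite, mul_zero, submatrix_apply, id]
    rw [Finset.sum_comm]
    simp only [Finset.sum_ite_eq', Finset.mem_univ, if_true]
    rw [← Finset.sum_mul, h3]
    by_cases hj : j = 0
    · simp [hj, mapMatrix, one_apply]
    · simp [hj]
  refine IsActionImage.of_krausMap (J := fun _ => D) B ?_ (fun v hv i => ?_)
    (fun v hv hvu i i' => ?_) ?_
  · ext y y'
    have h1 : ∀ i, (∑ j, (B i s j)ᴴ * B i s j) y y' = if y.1.2 = y'.1.2 then
        bellAmp D * bellAmp D * (pauli i y.1.1 y.2 * star (pauli i y'.1.1 y'.2)) else 0 := by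
      intro i
      have h2 := sum_star_ite_mul_ite (fun _ : (D × P s) × D => (0 : D))
        (fun y => ((0 : D), y.1.2)) (fun y => bellAmp D * star (pauli i y.1.1 y.2)) y y'
      simp only [Matrix.sum_apply, mul_apply, conjTranspose_apply, B, of_apply, if_true]
      rw [h2]
      refine if_congr (by simp) ?_ rfl
      rw [star_mul', star_star, star_bellAmp]
      ring
    rw [Matrix.sum_apply]
    simp only [h1]
    by_cases h2 : y.1.2 = y'.1.2
    · simp only [if_pos h2, ← Finset.mul_sum, sum_pauli, mul_ite, bellAmp_mul_self, mul_zero,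
        one_apply]
      refine if_congr ?_ rfl rfl
      simp only [Prod.ext_iff, h2, and_true]
    · have : y ≠ y' := fun h => h2 (by rw [h])
      simp [h2, this]
  · ext y y'
    simp only [Matrix.sum_apply, mul_apply, conjTranspose_apply, B, of_apply, if_neg hv, one_apply]
    by_cases hu : v = u
    · simp only [if_pos hu, Fintype.sum_prod_type]
      rw [Finset.sum_comm]
      have h2 := fun q : D => sum_star_ite_mul_ite (fun y : (D × P v) × D => y.1.1)
        (fun y => y.1.2) (fun y => pauli i q y.2) y y'
      simp only [h2]
      by_cases h3 : y.1.1 = y'.1.1 ∧ y.1.2 = y'.1.2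
      · simp only [if_pos h3, sum_star_pauli_mul]
        refine if_congr ?_ rfl rfl
        simp only [Prod.ext_iff, h3, and_true, true_and]
      · have : y ≠ y' := fun h => h3 (by rw [h]; exact ⟨rfl, rfl⟩)
        simp [h3, this]
    · simp only [if_neg hu]
      rw [sum_star_ite_mul_ite (fun y : (D × P v) × D => y.2) (fun y => y.1) (fun _ => 1)]
      refine if_congr ?_ (by simp) rfl
      rw [and_comm, ← Prod.ext_iff]
  · have hvu' : v ≠ u := hvu
    funext j
    simp [B, hv, hvu']
  · have h1 : ∀ i, krausMap (B i) (tens (push E N) (bellState D s u)) =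
        (bellAmp D * bellAmp D * (bellAmp D * bellAmp D)) • push E' N := by
      intro i
      have h2 : ∀ j : V → D, tensorOp (fun v => B i v (j v)) * tens (push E N) (bellState D s u) *
          (tensorOp fun v => B i v (j v))ᴴ = (tensorOp (fun v => B i v (j v)) *
            (mapMatrix F * L)) * N * (tensorOp (fun v => B i v (j v)) * (mapMatrix F * L))ᴴ :=
        fun j => by
          rw [hst, conjTranspose_mul (tensorOp _)]
          simp only [Matrix.mul_assoc]
      rw [krausMap, Finset.sum_congr rfl fun j _ => h2 j]
      simp only [key]
      rw [Finset.sum_eq_single 0]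
      · simp only [if_true, conjTranspose_smul, star_mul', star_bellAmp, Matrix.smul_mul,
          Matrix.mul_smul, smul_smul, push]
      · intro j _ hj
        simp [hj]
      · simp
    rw [Finset.sum_congr rfl fun i _ => h1 i, Finset.sum_const, Finset.card_univ,
      Fintype.card_prod, AddChar.card_eq, ← Nat.cast_smul_eq_nsmul ℂ, smul_smul]
    -- There are `d²` outcomes, each of probability `1 / d²`.
    have h2 : ((Fintype.card D * Fintype.card D : ℕ) : ℂ) *
        (bellAmp D * bellAmp D * (bellAmp D * bellAmp D)) = 1 := by
      push_cast
      linear_combination (bellAmp D * bellAmp D * Fintype.card D + 1) * bellAmp_mul_self (D := D)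
    rw [h2, one_smul]

end Teleport

/-! ## Data registers hosted by parties -/

section Hosting

open Matrix
open scoped Kronecker

variable {V : Type*} [DecidableEq V] {W D : Type} [AddCommGroup D]

/-- Every party has registers for all data `k : W`; the party `pos k` holds the datum `k`, and the
`k`-th registers of the other parties hold `0`. -/
def hostMap (pos : W → V) (z : W → D) (v : V) (k : W) : D :=
  if pos k = v then z k else 0

theorem hostMap_injective (pos : W → V) :
    Function.Injective (hostMap pos : (W → D) → V → W → D) := fun z z' h => funext fun k => by
  simpa [hostMap] using congrFun (congrFun h (pos k)) k

variable [Fintype V] [Fintype W] [DecidableEq W] [Fintype D] [DecidableEq D]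

/-- Teleportation applied to register `k`, which `p` splits off as the first register of each party;
the remaining registers and `N` are carried along. -/
theorem isActionImage_move {A : V → Type*} [∀ v, Fintype (A v)] [∀ v, DecidableEq (A v)]
    (pos : W → V) (k : W) {u : V} (hu : pos k ≠ u) (τ : Matrix (W → D) (W → D) ℂ)
    (N : Matrix (∀ v, A v) (∀ v, A v) ℂ) :
    IsActionImage (pos k) {u} (tens (push (hostMap pos) τ) (tens N (bellState D (pos k) u)))
      (tens (push (hostMap (Function.update pos k u)) τ) N) := by
  let p : ∀ v, (W → D) × A v ≃ D × (({j // j ≠ k} → D) × A v) := fun v =>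
    ((Equiv.funSplitAt k D).prodCongr (Equiv.refl (A v))).trans (Equiv.prodAssoc _ _ _)
  let q : ∀ v, (W → D) × (A v × D) ≃ (D × (({j // j ≠ k} → D) × A v)) × D := fun v =>
    (Equiv.prodAssoc _ _ _).symm.trans ((p v).prodCongr (Equiv.refl D))
  have h1 := IsLocalImage.relabel q
    (tens (push (hostMap pos) τ) (tens N (bellState D (pos k) u)))
  let E : (W → D) × (∀ v, A v) → ∀ v, D × (({j // j ≠ k} → D) × A v) := fun x v =>
    p v (hostMap pos x.1 v, x.2 v)
  have h2 : (tens (push (hostMap pos) τ) (tens N (bellState D (pos k) u))).submatrix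
      (Equiv.piCongrRight q).symm (Equiv.piCongrRight q).symm =
      tens (push E (τ ⊗ₖ N)) (bellState D (pos k) u) := by
    have h3 : push E (τ ⊗ₖ N) = (tens (push (hostMap pos) τ) N).submatrix
        (Equiv.piCongrRight p).symm (Equiv.piCongrRight p).symm := by
      rw [← push_equiv, tens_push, push_push]
      rfl
    rw [h3]
    ext x y
    exact (mul_assoc _ _ _).symm
  rw [h2] at h1
  have h4 := isActionImage_teleport hu E (fun z => by
    simp [E, p, hostMap, Equiv.funSplitAt, Equiv.piSplitAt, hu]) (τ ⊗ₖ N)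
  have h5 := IsLocalImage.relabel (fun v => (p v).symm) (push (fun z v =>
    if v = pos k then (0, (E z v).2) else if v = u then ((E z (pos k)).1, (E z v).2) else E z v)
      (τ ⊗ₖ N))
  rw [← push_equiv, push_push] at h5
  have h6 := ((h1.isActionImage (pos k) {u}).trans h4).trans (h5.isActionImage (pos k) {u})
  rw [tens_push (hostMap (Function.update pos k u))]
  suffices hfun : (fun (z : (W → D) × (∀ v, A v)) v =>
      (hostMap (Function.update pos k u) z.1 v, z.2 v)) =
      (Equiv.piCongrRight fun v => (p v).symm) ∘ fun z v => if v = pos k then (0, (E z v).2) else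
        if v = u then ((E z (pos k)).1, (E z v).2) else E z v by
    rw [hfun]
    exact h6
  funext z v
  apply (p v).injective
  simp only [Function.comp_apply, Equiv.piCongrRight_apply, Pi.map_apply, Equiv.apply_symm_apply]
  have h7 : (p v (hostMap (Function.update pos k u) z.1 v, z.2 v)).2 = (E z v).2 := by
    refine Prod.ext (funext fun j => ?_) rfl
    simp [p, E, hostMap, Equiv.funSplitAt, Equiv.piSplitAt, j.2]
  have h8 : (p v (hostMap (Function.update pos k u) z.1 v, z.2 v)).1 =
      if u = v then z.1 k else 0 := by
    simp [p, hostMap, Equiv.funSplitAt, Equiv.piSplitAt]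
  have h9 : ∀ v, (E z v).1 = if pos k = v then z.1 k else 0 := fun v => by
    simp [p, E, hostMap, Equiv.funSplitAt, Equiv.piSplitAt]
  refine Prod.ext ?_ ?_
  · rw [h8]
    by_cases hv : v = pos k
    · simp [hv, hu.symm]
    · by_cases hv' : v = u
      · rw [if_neg hv, if_pos hv', h9, if_pos hv'.symm, if_pos rfl]
      · rw [if_neg hv, if_neg hv', h9, if_neg (Ne.symm hv), if_neg (Ne.symm hv')]
  · rw [h7]
    split_ifs <;> rfl

/-- The data in the state `τ`, hosted by the parties `pos`, next to the state `B`. -/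
def hostedState (pos : W → V) (τ : Matrix (W → D) (W → D) ℂ) (B : MultiState V) :
    MultiState V where
  sys v := (W → D) × B.sys v
  mat := tens (push (hostMap pos) τ) B.mat

/-- The data are moved one at a time, and `B'` consists of `B` and one Bell pair for every datum
that moves. -/
theorem exists_reflTransGen_hostedState {G : QNetwork V}
    {r : MultiState V → MultiState V → Prop} {pos pos' : W → V}
    (h : ∀ k, pos k = pos' k ∨ (G.graph.Adj (pos k) (pos' k) ∧
      ∀ σ σ' : MultiState V, IsActionImage (pos k) {pos' k} σ.mat σ'.mat → r σ σ'))
    (τ : Matrix (W → D) (W → D) ℂ) (B : MultiState V) (hB : G.IsResource B.mat) :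
    ∃ B' : MultiState V, G.IsResource B'.mat ∧
      Relation.ReflTransGen r (hostedState pos τ B') (hostedState pos' τ B) := by
  suffices H : ∀ (S : Finset W) (B : MultiState V), G.IsResource B.mat →
      ∃ B' : MultiState V, G.IsResource B'.mat ∧ Relation.ReflTransGen r (hostedState pos τ B')
        (hostedState (fun k => if k ∈ S then pos' k else pos k) τ B) by
    simpa using H Finset.univ B hB
  intro S
  induction S using Finset.induction_on with
  | empty => exact fun B hB => ⟨B, hB, by simpa using Relation.ReflTransGen.refl⟩
  | insert k S hk ih =>
    intro B hB
    set posS : W → V := fun k => if k ∈ S then pos' k else pos k with hposS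
    have hk' : posS k = pos k := by simp [hposS, hk]
    have hins : (fun j => if j ∈ insert k S then pos' j else pos j) =
        Function.update posS k (pos' k) := by
      funext j
      by_cases hj : j = k
      · subst hj
        simp
      · simp [hposS, hj]
    rw [hins]
    obtain hkk | ⟨hadj, hr⟩ := h k
    · rw [← hkk, ← hk', Function.update_eq_self]
      exact ih B hB
    -- Datum `k` moves last, so its Bell pair must survive the earlier moves: the induction
    -- hypothesis is used for the enlarged resource.
    · let B₁ : MultiState V := ⟨fun v => B.sys v × D, tens B.mat (bellState D (pos k) (pos' k))⟩
      obtain ⟨B', hB', hB''⟩ := ih B₁ (hB.tens (G.isResource_bellState hadj))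
      refine ⟨B', hB', hB''.tail (hr _ _ ?_)⟩
      have := isActionImage_move posS k (u := pos' k) (hk' ▸ hadj.ne) τ B.mat
      rw [hk'] at this
      exact this

/-- Next to any resource, `τ` hosted by the parties `pos` can be prepared in `t`
transformations. -/
def QNetwork.Hostable (G : QNetwork V) (next : MultiState V → MultiState V → Prop) (t : ℕ)
    (pos : W → V) (τ : Matrix (W → D) (W → D) ℂ) : Prop :=
  ∀ B : MultiState V, G.IsResource B.mat → hostedState pos τ B ∈ G.preparable next t

theorem QNetwork.Hostable.of_isResource {G : QNetwork V}
    {next : MultiState V → MultiState V → Prop} {pos : W → V} {τ : Matrix (W → D) (W → D) ℂ}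
    (h : G.IsResource (push (hostMap pos) τ)) : G.Hostable next 0 pos τ :=
  fun _ hB => h.tens hB

/-- All teleportations go from `S` to `R`, hence form one step. The Bell pairs they use are part of
the resource next to which the previous stage is prepared; this is why `Hostable` allows any
resource. -/
theorem QNetwork.Hostable.step {G : QNetwork V} {S R : Set V} (hSR : Disjoint S R) {t : ℕ}
    {pos pos' : W → V} {τ : Matrix (W → D) (W → D) ℂ}
    (h : ∀ k, pos k = pos' k ∨ (G.graph.Adj (pos k) (pos' k) ∧ pos k ∈ S ∧ pos' k ∈ R))
    (ht : G.Hostable G.IsStep t pos τ) : G.Hostable G.IsStep (t + 1) pos' τ := by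
  intro B hB
  obtain ⟨B', hB', hr⟩ := exists_reflTransGen_hostedState
    (r := fun σ σ' : MultiState V => ∃ s ∈ S, ∃ T ⊆ R, (∀ u ∈ T, G.graph.Adj s u) ∧
        IsActionImage s T σ.mat σ'.mat) (pos := pos) (pos' := pos')
    (fun k => (h k).imp_right fun ⟨h1, h2, h3⟩ => ⟨h1, fun σ σ' hσ =>
      ⟨pos k, h2, {pos' k}, by simpa using h3, by simpa using h1, hσ⟩⟩) τ B hB
  exact ⟨_, ht B' hB', S, R, hSR, hr⟩

/-- All teleportations have the same sender, so by `IsActionImage.trans` they merge into one round.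
-/
theorem QNetwork.Hostable.round {G : QNetwork V} (s : V) {t : ℕ}
    {pos pos' : W → V} {τ : Matrix (W → D) (W → D) ℂ}
    (h : ∀ k, pos k = pos' k ∨ (pos k = s ∧ G.graph.Adj s (pos' k)))
    (ht : G.Hostable IsRound t pos τ) : G.Hostable IsRound (t + 1) pos' τ := by
  intro B hB
  obtain ⟨B', hB', hr⟩ := exists_reflTransGen_hostedState
    (r := fun σ σ' : MultiState V => IsActionImage s Set.univ σ.mat σ'.mat)
    (pos := pos) (pos' := pos')
    (fun k => (h k).imp_right fun ⟨h1, h2⟩ => ⟨h1 ▸ h2, fun σ σ' hσ =>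
      (h1 ▸ hσ).mono (Set.subset_univ _)⟩) τ B hB
  refine ⟨_, ht B' hB', s, ?_⟩
  have key : ∀ σ σ' : MultiState V, Relation.ReflTransGen
      (fun σ σ' : MultiState V => IsActionImage s Set.univ σ.mat σ'.mat) σ σ' →
      IsActionImage s Set.univ σ.mat σ'.mat := by
    intro σ σ' hσ
    induction hσ with
    | refl => exact (IsLocalImage.refl σ.mat).isActionImage s _
    | tail _ h1 ih => exact ih.trans h1
  exact key _ _ hr

/-- Local channels can be carried out together with the transformation that precedes them. -/
def AbsorbsLocal (next : MultiState V → MultiState V → Prop) : Prop :=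
  ∀ σ σ' σ'' : MultiState V, next σ σ' → IsLocalImage σ'.mat σ''.mat →
    ∃ σ₁ : MultiState V, IsLocalImage σ.mat σ₁.mat ∧ next σ₁ σ''

theorem absorbsLocal_isRound : AbsorbsLocal (IsRound (V := V)) := fun σ _ _ ⟨s, h⟩ h' =>
  ⟨σ, .refl _, s, h.trans (h'.isActionImage s _)⟩

theorem QNetwork.absorbsLocal_isStep (G : QNetwork V) : AbsorbsLocal G.IsStep := by
  rintro σ σ' σ'' ⟨S, R, hSR, h⟩ h'
  obtain rfl | ⟨τ, h1, s, hs, T, hT, hadj, h2⟩ := Relation.ReflTransGen.cases_tail h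
  -- An empty step has no last round to absorb the channel, which is therefore applied before the
  -- step.
  · exact ⟨σ'', h', S, R, hSR, .refl⟩
  · exact ⟨σ, .refl _, S, R, hSR, h1.tail ⟨s, hs, T, hT, hadj,
      h2.trans (h'.isActionImage s _)⟩⟩

theorem QNetwork.preparable_of_isLocalImage {G : QNetwork V}
    {next : MultiState V → MultiState V → Prop} (hnext : AbsorbsLocal next) (k : ℕ)
    {σ σ' : MultiState V} (hσ : σ ∈ G.preparable next k) (h : IsLocalImage σ.mat σ'.mat) :
    σ' ∈ G.preparable next k := by
  induction k generalizing σ σ' with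
  | zero =>
    obtain ⟨γ, hγ⟩ := hσ
    exact ⟨γ, hγ.trans h⟩
  | succ k ih =>
    obtain ⟨τ, hτ, hτσ⟩ := hσ
    obtain ⟨τ₁, h1, h2⟩ := hnext _ _ _ hτσ h
    exact ⟨τ₁, ih hτ h1, h2⟩

theorem IsDensity.nonempty {ι : Type*} [Fintype ι] {ρ : Matrix ι ι ℂ} (hρ : IsDensity ρ) :
    Nonempty ι := by
  by_contra h
  rw [not_nonempty_iff] at h
  simpa [trace] using hρ.2

/-- The system of `v` is encoded in register `e v`, hosted by `v` itself, and decoded by a local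
channel at the end. `Fin (Fintype.card V)` replaces `V` because data are indexed by a `Type`. -/
theorem QNetwork.preparable_of_hostable {G : QNetwork V}
    {next : MultiState V → MultiState V → Prop} (hnext : AbsorbsLocal next) (t : ℕ)
    (h : ∀ (m : ℕ) (pos : Fin (Fintype.card V) → V)
      (τ : Matrix (Fin (Fintype.card V) → ZMod (m + 1)) (Fin (Fintype.card V) → ZMod (m + 1)) ℂ),
      IsDensity τ → G.Hostable next t pos τ)
    {a : V → Type} [∀ v, Fintype (a v)] [∀ v, DecidableEq (a v)]
    {ρ : Matrix (∀ v, a v) (∀ v, a v) ℂ} (hρ : IsDensity ρ) :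
    (⟨a, ρ⟩ : MultiState V) ∈ G.preparable next t := by
  classical
  have : ∀ v, Nonempty (a v) := fun v => hρ.nonempty.map fun x => x v
  let e : V ≃ Fin (Fintype.card V) := Fintype.equivFin V
  -- `ZMod (m + 1)` is a finite abelian group into which every `a v` embeds.
  let m := ∑ v, Fintype.card (a v)
  have hι : ∀ v, ∃ ι : a v → ZMod (m + 1), Function.Injective ι := fun v => by
    have : Fintype.card (a v) ≤ Fintype.card (ZMod (m + 1)) := by
      rw [ZMod.card]
      exact (Finset.single_le_sum (f := fun v => Fintype.card (a v)) (fun _ _ => Nat.zero_le _)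
        (Finset.mem_univ v)).trans (Nat.le_succ _)
    obtain ⟨ι⟩ := Function.Embedding.nonempty_of_card_le this
    exact ⟨ι, ι.injective⟩
  choose ι hι using hι
  let enc : (∀ v, a v) → Fin (Fintype.card V) → ZMod (m + 1) := fun z k =>
    ι (e.symm k) (z (e.symm k))
  have henc : ∀ z v, enc z (e v) = ι v (z v) := fun z v => by
    have : ∀ w, w = v → ι w (z w) = ι v (z v) := by
      rintro _ rfl
      rfl
    exact this _ (e.symm_apply_apply v)
  have henc_inj : Function.Injective enc := fun z z' h => funext fun v => hι v <| by
    rw [← henc, ← henc, h]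
  let canon : ∀ v, a v → Fin (Fintype.card V) → ZMod (m + 1) := fun v t k =>
    if k = e v then ι v t else 0
  let f : ∀ v, (Fin (Fintype.card V) → ZMod (m + 1)) → a v := fun v x =>
    Function.invFun (ι v) (x (e v))
  -- `none` marks correctly encoded contents; for others the whole contents are kept, so that `f`
  -- and `g` are jointly injective.
  let g : ∀ v : V, (Fin (Fintype.card V) → ZMod (m + 1)) →
      Option (Fin (Fintype.card V) → ZMod (m + 1)) := fun v x =>
    if x = canon v (f v x) then none else some x
  have hhost : ∀ z v, hostMap e.symm (enc z) v = canon v (z v) := fun z v => funext fun k => by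
    by_cases hk : k = e v
    · subst hk
      simp [hostMap, canon, henc]
    · have : e.symm k ≠ v := fun h => hk (by rw [← h, e.apply_symm_apply])
      simp [hostMap, canon, hk, this]
  have hf : ∀ z v, f v (hostMap e.symm (enc z) v) = z v := fun z v => by
    rw [hhost]
    simp [f, canon, Function.leftInverse_invFun (hι v) _]
  have h1 := h m e.symm (push enc ρ) (hρ.push henc_inj) ⟨fun _ => Unit, 1⟩ G.isResource_unit
  refine G.preparable_of_isLocalImage hnext t h1 ?_
  have h2 := IsLocalImage.relabel
    (fun _ : V => Equiv.prodUnique (Fin (Fintype.card V) → ZMod (m + 1)) Unit)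
    (tens (push (hostMap e.symm) (push enc ρ)) (1 : Matrix (V → Unit) (V → Unit) ℂ))
  refine h2.trans ?_
  have h3 : (tens (push (hostMap e.symm) (push enc ρ))
      (1 : Matrix (V → Unit) (V → Unit) ℂ)).submatrix
      (Equiv.piCongrRight fun _ : V =>
        Equiv.prodUnique (Fin (Fintype.card V) → ZMod (m + 1)) Unit).symm
      (Equiv.piCongrRight fun _ : V =>
        Equiv.prodUnique (Fin (Fintype.card V) → ZMod (m + 1)) Unit).symm =
      push (hostMap e.symm ∘ enc) ρ := by
    rw [← push_push]
    ext x y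
    simp [tens, one_apply, Equiv.piCongrRight]
  rw [h3]
  have h4 := isLocalImage_push f g (fun v p p' hp hp' => ?_) (hostMap e.symm ∘ enc)
    (fun _ => none) (fun z v => ?_) ρ
  · have h5 : (fun z v => f v ((hostMap e.symm ∘ enc) z v)) = id := by
      funext z v
      exact hf z v
    rw [h5, push_id] at h4
    exact h4
  · by_cases h5 : p = canon v (f v p) <;> by_cases h6 : p' = canon v (f v p')
    · rw [h5, h6, hp]
    · simp [g, ← h5, h6] at hp'
    · simp [g, h5, ← h6] at hp'
    · simpa [g, h5, h6] using hp'
  · simp only [g, Function.comp_apply, hf, if_pos (hhost z v)]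

end Hosting

/-! ## Preparing arbitrary states -/

section Protocols

open Matrix

/-- The parties at distance at most `t` from the edge `e`. -/
def QNetwork.reach {V : Type*} (G : QNetwork V) (e : Finset V) : ℕ → Set V
  | 0 => e
  | t + 1 => {u | u ∈ G.reach e t ∨ ∃ v ∈ G.reach e t, G.graph.Adj v u}

theorem QNetwork.mem_reach_of_walk {V : Type*} {G : QNetwork V} {e : Finset V} {u v : V}
    (p : G.graph.Walk u v) (hv : v ∈ e) :
    u ∈ G.reach e p.length := by
  induction p with
  | nil => exact hv
  | cons h _ ih => exact Or.inr ⟨_, ih hv, h.symm⟩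

theorem QNetwork.reach_mono {V : Type*} (G : QNetwork V) (e : Finset V) : Monotone (G.reach e) :=
  monotone_nat_of_le_succ fun _ _ h => Or.inl h

variable {V : Type*} [Fintype V] [DecidableEq V] {G : QNetwork V} {a : V → Type}
  [∀ v, Fintype (a v)] [∀ v, DecidableEq (a v)] {ρ : Matrix (∀ v, a v) (∀ v, a v) ℂ}

theorem QNetwork.cost_le_of_preparable {next : MultiState V → MultiState V → Prop} {k : ℕ}
    (h : (⟨a, ρ⟩ : MultiState V) ∈ G.preparable next k) : G.cost next ρ ≤ k := by
  have hk : ρ ∈ G.achievable next k := subset_closure (subset_convexHull ℝ _ h)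
  exact iInf₂_le (f := fun (k : ℕ) (_ : ρ ∈ G.achievable next k) => (k : ℕ∞)) k hk

/-- For `t = 0` the source `e` distributes `τ` itself. After that, a datum bound for the outside of
`reach e t` waits at a neighbour inside, and all others stay put; thus senders lie in `reach e t`
and receivers in its complement. -/
theorem QNetwork.hostable_isStep {W D : Type} [Fintype W] [DecidableEq W] [AddCommGroup D]
    [Fintype D] [DecidableEq D] {e : Finset V} (he : e ∈ G.edges)
    {τ : Matrix (W → D) (W → D) ℂ} (hτ : IsDensity τ) (t : ℕ) (pos : W → V)
    (hpos : ∀ k, pos k ∈ G.reach e t) : G.Hostable G.IsStep t pos τ := by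
  classical
  induction t generalizing pos with
  | zero =>
    refine .of_isResource (G.isResource_push he 0 (hostMap_injective pos) (fun z v hv => ?_) hτ)
    funext k
    have : pos k ≠ v := fun h => hv (h ▸ hpos k)
    simp [hostMap, this]
  | succ t ih =>
    have h : ∀ k, ∃ v ∈ G.reach e t, v = pos k ∨
        (G.graph.Adj v (pos k) ∧ pos k ∉ G.reach e t) := fun k => by
      by_cases hk : pos k ∈ G.reach e t
      · exact ⟨_, hk, Or.inl rfl⟩
      · obtain hk' | ⟨v, hv, hvk⟩ := hpos k
        · exact absurd hk' hk
        · exact ⟨v, hv, Or.inr ⟨hvk, hk⟩⟩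
    choose pos' h1 h2 using h
    exact (ih pos' h1).step (disjoint_compl_right (a := G.reach e t))
      fun k => (h2 k).imp_right fun ⟨h3, h4⟩ => ⟨h3, h1 k, h4⟩

theorem QNetwork.cost_isStep_le (hρ : IsDensity ρ) : G.cost G.IsStep ρ ≤ G.edgeRadius := by
  refine le_iInf₂ fun e he => ?_
  by_cases htop : (⨆ u : V, ⨅ v ∈ e, G.graph.edist u v) = ⊤
  · rw [htop]
    exact le_top
  obtain ⟨k, hk⟩ := ENat.ne_top_iff_exists.mp htop
  rw [← hk]
  refine G.cost_le_of_preparable (G.preparable_of_hostable G.absorbsLocal_isStep k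
    (fun m pos τ hτ => G.hostable_isStep he hτ k pos fun j => ?_) hρ)
  have h1 : (⨅ v ∈ e, G.graph.edist (pos j) v) ≤ k :=
    hk ▸ le_iSup (fun u => ⨅ v ∈ e, G.graph.edist u v) (pos j)
  -- The infimum over `e` is attained because hyperedges are finite and nonempty.
  obtain ⟨v, hv, hmin⟩ := e.exists_min_image (G.graph.edist (pos j)) (G.edges_nonempty e he)
  have h2 : G.graph.edist (pos j) v ≤ k := (le_iInf₂ hmin).trans h1
  have h3 : G.graph.edist (pos j) v ≠ ⊤ := ne_top_of_le_ne_top (ENat.natCast_ne_top k) h2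
  obtain ⟨p, hp⟩ := SimpleGraph.exists_walk_of_edist_ne_top h3
  refine G.reach_mono e ?_ (G.mem_reach_of_walk p hv)
  rw [← hp] at h2
  exact_mod_cast h2

/-- With senders from `T`, one round for each, all states can be distributed to the parties in `T`
and their neighbours. -/
def QNetwork.RoundsSuffice (G : QNetwork V) (T : Finset V) : Prop :=
  ∀ (m : ℕ) (pos : Fin (Fintype.card V) → V)
    (τ : Matrix (Fin (Fintype.card V) → ZMod (m + 1)) (Fin (Fintype.card V) → ZMod (m + 1)) ℂ),
    IsDensity τ → (∀ k, pos k ∈ T ∨ ∃ v ∈ T, G.graph.Adj v (pos k)) →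
      G.Hostable IsRound T.card pos τ

/-- `s` prepares all of `τ` locally and then uses its round to teleport the data to its neighbours.
-/
theorem QNetwork.roundsSuffice_singleton (G : QNetwork V) (s : V) : G.RoundsSuffice {s} := by
  intro m pos τ hτ hpos
  have h : G.Hostable IsRound 0 (fun _ => s) τ := by
    refine .of_isResource ?_
    have h1 := G.isResource_push_single s 0 hτ
    convert h1 using 2
    funext z v k
    by_cases hv : v = s
    · simp [hostMap, hv]
    · simp [hostMap, hv, Ne.symm hv]
  refine h.round s fun k => ?_
  obtain hk | ⟨v, hv, hvk⟩ := hpos k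
  · exact Or.inl (Finset.mem_singleton.mp hk).symm
  · exact Or.inr ⟨rfl, Finset.mem_singleton.mp hv ▸ hvk⟩

/-- As a neighbour of `T`, the node `s` can itself receive data in the first `T.card` rounds. Data
for parties that `T` does not serve go to `s`, which forwards them in the additional round. -/
theorem QNetwork.RoundsSuffice.insert {T : Finset V} (hT : G.RoundsSuffice T) {s v : V}
    (hs : s ∉ T) (hv : v ∈ T) (hvs : G.graph.Adj v s) : G.RoundsSuffice (insert s T) := by
  classical
  intro m pos τ hτ hpos
  rw [Finset.card_insert_of_notMem hs]
  have h : ∀ k, ∃ w, (w ∈ T ∨ ∃ v ∈ T, G.graph.Adj v w) ∧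
      (w = pos k ∨ (w = s ∧ G.graph.Adj s (pos k))) := fun k => by
    by_cases hk : pos k ∈ T ∨ ∃ v ∈ T, G.graph.Adj v (pos k)
    · exact ⟨_, hk, Or.inl rfl⟩
    · refine ⟨s, Or.inr ⟨v, hv, hvs⟩, ?_⟩
      obtain h1 | ⟨w, hw, hwk⟩ := hpos k
      · obtain h1 | h1 := Finset.mem_insert.mp h1
        · exact Or.inl h1.symm
        · exact absurd (Or.inl h1) hk
      · obtain rfl | h1 := Finset.mem_insert.mp hw
        · exact Or.inr ⟨rfl, hwk⟩
        · exact absurd (Or.inr ⟨w, h1, hwk⟩) hk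
  choose pos' h1 h2 using h
  exact (hT m pos' τ hτ h1).round s h2

/-- A maximal good subset `T` containing `s` is all of `S`: otherwise connectedness gives an edge
leaving `T`, and its endpoint could be added. -/
theorem QNetwork.roundsSuffice_of_connected {S : Finset V}
    (hS : (G.graph.induce (S : Set V)).Connected) : G.RoundsSuffice S := by
  classical
  obtain ⟨⟨s, hs⟩⟩ := hS.nonempty
  obtain ⟨T, hT, hmax⟩ := (S.powerset.filter fun T => s ∈ T ∧ G.RoundsSuffice T).exists_max_image
    Finset.card ⟨{s}, by simpa [G.roundsSuffice_singleton s] using hs⟩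
  simp only [Finset.mem_filter, Finset.mem_powerset] at hT hmax
  obtain ⟨hTS, hsT, hT⟩ := hT
  have : T = S := by
    by_contra hne
    obtain ⟨u, huS, huT⟩ := Finset.exists_of_ssubset (hTS.ssubset_of_ne hne)
    obtain ⟨p⟩ := hS.preconnected ⟨s, hs⟩ ⟨u, huS⟩
    obtain ⟨d, -, hd1, hd2⟩ := p.exists_boundary_dart (Subtype.val ⁻¹' (T : Set V)) hsT huT
    have hmem : (d.snd : V) ∈ S := d.snd.2
    have := hmax (insert d.snd.1 T) ⟨Finset.insert_subset hmem hTS, Finset.mem_insert_of_mem hsT,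
      hT.insert hd2 hd1 d.adj⟩
    rw [Finset.card_insert_of_notMem hd2] at this
    omega
  exact this ▸ hT

theorem QNetwork.cost_isRound_le (hρ : IsDensity ρ) : G.cost IsRound ρ ≤ G.connDomNumber := by
  refine le_iInf fun S => le_iInf₂ fun hS hdom => ?_
  refine G.cost_le_of_preparable (G.preparable_of_hostable absorbsLocal_isRound S.card
    (fun m pos τ hτ => G.roundsSuffice_of_connected hS m pos τ hτ fun k => ?_) hρ)
  by_cases hk : pos k ∈ S
  · exact Or.inl hk
  · obtain ⟨v, hv, hvk⟩ := hdom _ hk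
    exact Or.inr ⟨v, hv, hvk.symm⟩

end Protocols

/-! ## Weights and convex roofs -/

section Weight

open Matrix
open scoped MatrixOrder

theorem convex_isDensity (ι : Type*) [Fintype ι] : Convex ℝ {ρ : Matrix ι ι ℂ | IsDensity ρ} := by
  intro ρ hρ σ hσ p q hp hq hpq
  refine ⟨(hρ.1.smul hp).add (hσ.1.smul hq), ?_⟩
  rw [trace_add, trace_smul, trace_smul, hρ.2, hσ.2, ← add_smul, hpq, one_smul]

theorem isClosed_isDensity (ι : Type*) [Fintype ι] :
    IsClosed {ρ : Matrix ι ι ℂ | IsDensity ρ} := by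
  classical
  have h : {ρ : Matrix ι ι ℂ | IsDensity ρ} =
      {ρ | ρᴴ = ρ} ∩ (⋂ x : ι → ℂ, {ρ | 0 ≤ star x ⬝ᵥ (ρ *ᵥ x)}) ∩ {ρ | ρ.trace = 1} := by
    ext ρ
    simp only [IsDensity, posSemidef_iff_dotProduct_mulVec, IsHermitian, Set.mem_inter_iff,
      Set.mem_iInter, Set.mem_ofPred_eq]
  rw [h]
  refine ((isClosed_eq (by fun_prop) (by fun_prop)).inter
    (isClosed_iInter fun x => isClosed_le (by fun_prop) (by fun_prop))).inter
    (isClosed_eq (by fun_prop) (by fun_prop))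

/-- Write `M = Cᴴ * C` and apply `2xy ≤ x² + y²` to the products of entries; the trace is the sum of
all `‖C k l‖ ^ 2`. -/
theorem Matrix.PosSemidef.norm_apply_le_trace {ι : Type*} [Fintype ι] {M : Matrix ι ι ℂ}
    (hM : M.PosSemidef) (i j : ι) : ‖M i j‖ ≤ M.trace.re := by
  classical
  obtain ⟨C, hC⟩ := CStarAlgebra.nonneg_iff_eq_star_mul_self.mp hM.nonneg
  have hC' : M = Cᴴ * C := hC
  have htr : M.trace.re = ∑ k, ∑ l, ‖C k l‖ ^ 2 := by
    rw [hC', trace, Finset.sum_comm, Complex.re_sum]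
    refine Finset.sum_congr rfl fun l _ => ?_
    simp only [diag_apply, mul_apply, conjTranspose_apply, Complex.re_sum, Complex.star_def,
      Complex.conj_mul']
    norm_cast
  rw [htr, hC', mul_apply]
  refine (norm_sum_le _ _).trans (Finset.sum_le_sum fun k _ => ?_)
  have h1 : ∀ l, ‖C k l‖ ^ 2 ≤ ∑ l, ‖C k l‖ ^ 2 := fun l =>
    Finset.single_le_sum (f := fun l => ‖C k l‖ ^ 2) (fun _ _ => sq_nonneg _) (Finset.mem_univ l)
  rw [norm_mul, conjTranspose_apply, norm_star]
  linarith [two_mul_le_add_sq ‖C k i‖ ‖C k j‖, h1 i, h1 j]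

theorem convexRoof_le_self {V : Type*} [Fintype V] [DecidableEq V] {a : V → Type}
    [∀ v, Fintype (a v)] {ρ : Matrix (∀ v, a v) (∀ v, a v) ℂ}
    (r : Matrix (∀ v, a v) (∀ v, a v) ℂ → ℕ∞) (hρ : IsDensity ρ) :
    convexRoof r ρ ≤ (r ρ : ℝ≥0∞) := by
  refine iInf_le_of_le 1 (iInf_le_of_le (fun _ => 1) (iInf_le_of_le (fun _ => ρ)
    (iInf_le_of_le ⟨fun _ => hρ, by simp, by simp⟩ ?_)))
  simp

theorem convexRoof_le_of_eq_add {V : Type*} [Fintype V] [DecidableEq V] {a : V → Type}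
    [∀ v, Fintype (a v)] {ρ : Matrix (∀ v, a v) (∀ v, a v) ℂ}
    (r : Matrix (∀ v, a v) (∀ v, a v) ℂ → ℕ∞)
    {σ τ : Matrix (∀ v, a v) (∀ v, a v) ℂ} (hσ : IsDensity σ) (hτ : IsDensity τ)
    {p : ℝ} (hp₀ : 0 ≤ p) (hp₁ : p ≤ 1) (h : ρ = (1 - p) • σ + p • τ) :
    convexRoof r ρ ≤
      ENNReal.ofReal (1 - p) * (r σ : ℝ≥0∞) + ENNReal.ofReal p * (r τ : ℝ≥0∞) := by
  refine iInf_le_of_le 2 (iInf_le_of_le ![(1 - p).toNNReal, p.toNNReal] (iInf_le_of_le ![σ, τ]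
    (iInf_le_of_le ⟨?_, ?_, ?_⟩ ?_)))
  · intro i
    fin_cases i
    · exact hσ
    · exact hτ
  · rw [Fin.sum_univ_two]
    apply NNReal.coe_injective
    simp [hp₀, hp₁]
  · rw [Fin.sum_univ_two]
    simp [hp₀, hp₁, h]
  · rw [Fin.sum_univ_two]
    simp [ENNReal.ofReal]

theorem QNetwork.isDensity_of_mem_freeStates {V : Type*} [Fintype V] [DecidableEq V]
    {G : QNetwork V} {a : V → Type} [∀ v, Fintype (a v)] {σ : Matrix (∀ v, a v) (∀ v, a v) ℂ}
    (hσ : σ ∈ G.freeStates a) : IsDensity σ :=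
  closure_minimal (convexHull_min (by
      rintro _ ⟨γ, h⟩
      exact h.isDensity γ.isDensity_netState) (convex_isDensity _)) (isClosed_isDensity _) hσ

/-- `ρ - σ` is the difference of `ρ - (1 - p) • σ` and `p • σ`, both positive of trace `p`. As `p →
0`, free states converge to `ρ`, and `freeStates` is closed. -/
theorem QNetwork.mem_freeStates_of_weight_eq_zero {V : Type*} [Fintype V] [DecidableEq V]
    {G : QNetwork V} {a : V → Type} [∀ v, Fintype (a v)] {ρ : Matrix (∀ v, a v) (∀ v, a v) ℂ}
    (hρ : IsDensity ρ) (h : G.weight ρ = 0) :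
    ρ ∈ G.freeStates a := by
  have h1 : ∀ n : ℕ, ∃ σ ∈ G.freeStates a, ∀ x y, ‖(ρ - σ) x y‖ ≤ 2 * (1 / ((n : ℝ) + 1)) := by
    intro n
    have hn : (0 : ℝ) < 1 / ((n : ℝ) + 1) := Nat.one_div_pos_of_nat
    have h2 : G.weight ρ < ENNReal.ofReal (1 / ((n : ℝ) + 1)) := by
      rw [h]
      exact ENNReal.ofReal_pos.mpr hn
    simp only [QNetwork.weight, iInf_lt_iff] at h2
    obtain ⟨p, σ, hσ, hps, hp⟩ := h2
    have hp1 : p < 1 / ((n : ℝ) + 1) := (ENNReal.ofReal_lt_ofReal_iff hn).mp hp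
    have hσd := G.isDensity_of_mem_freeStates hσ
    have htr : (ρ - (1 - p) • σ).trace = p := by
      rw [trace_sub, trace_smul, hρ.2, hσd.2]
      simp
    have hp0 : 0 ≤ p := by
      have := hps.trace_nonneg
      rw [htr] at this
      exact_mod_cast this
    refine ⟨σ, hσ, fun x y => ?_⟩
    have h3 := hps.norm_apply_le_trace x y
    rw [htr, Complex.ofReal_re] at h3
    have h4 : ‖(p • σ) x y‖ ≤ p := by
      have := hσd.1.norm_apply_le_trace x y
      rw [hσd.2, Complex.one_re] at this
      rw [Matrix.smul_apply, norm_smul, Real.norm_of_nonneg hp0]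
      exact mul_le_of_le_one_right hp0 this
    have h5 : ρ - σ = (ρ - (1 - p) • σ) - p • σ := by
      rw [sub_smul, one_smul]
      abel
    rw [h5, Matrix.sub_apply]
    refine (norm_sub_le _ _).trans ?_
    linarith
  choose σ hσ hσ' using h1
  refine isClosed_closure.mem_of_tendsto (f := σ) (b := Filter.atTop) ?_
    (Filter.Eventually.of_forall hσ)
  refine tendsto_pi_nhds.mpr fun x => tendsto_pi_nhds.mpr fun y => ?_
  rw [tendsto_iff_norm_sub_tendsto_zero]
  refine squeeze_zero (fun _ => norm_nonneg _) (fun n => ?_)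
    (g := fun n : ℕ => 2 * (1 / ((n : ℝ) + 1))) ?_
  · rw [norm_sub_rev]
    exact hσ' n x y
  · simpa using (tendsto_one_div_add_atTop_nhds_zero_nat (𝕜 := ℝ)).const_mul 2

variable {V : Type*} [Fintype V] [DecidableEq V] {G : QNetwork V} {a : V → Type}
  [∀ v, Fintype (a v)] [∀ v, DecidableEq (a v)] {ρ : Matrix (∀ v, a v) (∀ v, a v) ℂ}

theorem QNetwork.convex_freeStates (G : QNetwork V) (a : V → Type) [∀ v, Fintype (a v)] :
    Convex ℝ (G.freeStates a) :=
  (convex_convexHull ℝ _).closure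

theorem QNetwork.freeStates_nonempty (G : QNetwork V) (hρ : IsDensity ρ) :
    (G.freeStates a).Nonempty := by
  have : ∀ v, Nonempty (a v) := fun v => hρ.nonempty.map fun x => x v
  obtain ⟨M, hM⟩ := G.exists_isResource a
  exact ⟨M, subset_closure (subset_convexHull ℝ _ hM)⟩

theorem QNetwork.weight_ne_top (G : QNetwork V) (hρ : IsDensity ρ) : G.weight ρ ≠ ⊤ := by
  obtain ⟨σ, hσ⟩ := G.freeStates_nonempty hρ
  have h : (ρ - (1 - (1 : ℝ)) • σ).PosSemidef := by simpa using hρ.1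
  exact ne_top_of_le_ne_top ENNReal.ofReal_ne_top
    (iInf_le_of_le 1 (iInf₂_le_of_le σ hσ (iInf_le _ h)))

/-- By definition `G.achievable next 0` is `G.freeStates a`, for any `next`. -/
theorem QNetwork.cost_eq_zero {next : MultiState V → MultiState V → Prop}
    (h : ρ ∈ G.freeStates a) : G.cost next ρ = 0 :=
  nonpos_iff_eq_zero.mp (iInf₂_le 0 h)

theorem QNetwork.one_le_cost {next : MultiState V → MultiState V → Prop}
    (h : ρ ∉ G.freeStates a) : 1 ≤ G.cost next ρ := by
  refine le_iInf₂ fun k hk => ?_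
  have : k ≠ 0 := by
    rintro rfl
    exact h hk
  exact_mod_cast Nat.one_le_iff_ne_zero.mpr this

theorem QNetwork.weight_le_convexRoof (next : MultiState V → MultiState V → Prop)
    (hρ : IsDensity ρ) : G.weight ρ ≤ convexRoof (G.cost next) ρ := by
  classical
  refine le_iInf fun N => le_iInf fun p => le_iInf fun σ => le_iInf fun ⟨hσ, hp, hρσ⟩ => ?_
  let I : Finset (Fin N) := Finset.univ.filter fun i => σ i ∈ G.freeStates a
  let q : ℝ := ∑ i ∈ I, (p i : ℝ)
  have hp' : q + ∑ i ∈ Iᶜ, (p i : ℝ) = 1 := by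
    rw [Finset.sum_add_sum_compl]
    exact_mod_cast hp
  have hsum : ENNReal.ofReal (∑ i ∈ Iᶜ, (p i : ℝ)) ≤
      ∑ i, (p i : ℝ≥0∞) * (G.cost next (σ i) : ℝ≥0∞) := by
    rw [ENNReal.ofReal_sum_of_nonneg fun i _ => (p i).coe_nonneg]
    refine (Finset.sum_le_sum fun i hi => ?_).trans
      (Finset.sum_le_sum_of_subset (Finset.subset_univ Iᶜ))
    have hi' : σ i ∉ G.freeStates a := by simpa [I] using hi
    rw [ENNReal.ofReal_coe_nnreal]
    refine le_mul_of_one_le_right' ?_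
    exact_mod_cast G.one_le_cost hi'
  refine le_trans ?_ hsum
  have hrest : (∑ i ∈ Iᶜ, (p i : ℝ) • σ i).PosSemidef :=
    posSemidef_sum _ fun i _ => (hσ i).1.smul (p i).coe_nonneg
  have hsplit : ρ = ∑ i ∈ I, (p i : ℝ) • σ i + ∑ i ∈ Iᶜ, (p i : ℝ) • σ i := by
    rw [Finset.sum_add_sum_compl]
    exact hρσ
  -- `σ₀` is the normalized free part of the decomposition, or an arbitrary free state if that part
  -- has weight `0`.
  obtain ⟨σ₀, hσ₀, hσ₀'⟩ : ∃ σ₀ ∈ G.freeStates a, q • σ₀ = ∑ i ∈ I, (p i : ℝ) • σ i := by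
    have hq : 0 ≤ q := Finset.sum_nonneg fun i _ => (p i).coe_nonneg
    obtain hq | hq := hq.eq_or_lt
    · obtain ⟨σ₀, hσ₀⟩ := G.freeStates_nonempty hρ
      refine ⟨σ₀, hσ₀, ?_⟩
      have h0 := (Finset.sum_eq_zero_iff_of_nonneg fun i _ => (p i).coe_nonneg).mp hq.symm
      rw [← hq, zero_smul, Finset.sum_eq_zero fun i hi => by rw [h0 i hi, zero_smul]]
    · refine ⟨I.centerMass (fun i => (p i : ℝ)) σ, (G.convex_freeStates a).centerMass_mem
        (fun i _ => (p i).coe_nonneg) hq fun i hi => by simpa [I] using hi, ?_⟩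
      rw [Finset.centerMass, smul_inv_smul₀ hq.ne']
  refine iInf_le_of_le _ (iInf₂_le_of_le σ₀ hσ₀ (iInf_le _ ?_))
  rw [← hp', add_sub_cancel_right, hσ₀', hsplit, add_sub_cancel_left]
  exact hrest

theorem QNetwork.convexRoof_cost_le_mul {next : MultiState V → MultiState V → Prop} {R : ℕ∞}
    (hR : ∀ τ : Matrix (∀ v, a v) (∀ v, a v) ℂ, IsDensity τ → G.cost next τ ≤ R)
    (hρ : IsDensity ρ) {p : ℝ} {σ : Matrix (∀ v, a v) (∀ v, a v) ℂ} (hσ : σ ∈ G.freeStates a)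
    (h : (ρ - (1 - p) • σ).PosSemidef) :
    convexRoof (G.cost next) ρ ≤ (R : ℝ≥0∞) * ENNReal.ofReal p := by
  have hσd := G.isDensity_of_mem_freeStates hσ
  have htr : (ρ - (1 - p) • σ).trace = p := by
    rw [trace_sub, trace_smul, hρ.2, hσd.2]
    simp
  have hp : 0 ≤ p := by
    have := h.trace_nonneg
    rw [htr] at this
    exact_mod_cast this
  have hR' : ∀ τ : Matrix (∀ v, a v) (∀ v, a v) ℂ, IsDensity τ →
      (G.cost next τ : ℝ≥0∞) ≤ (R : ℝ≥0∞) := fun τ hτ => by exact_mod_cast hR τ hτ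
  -- `weight` does not restrict `p` to `[0, 1]`. Traces give `p ≥ 0`; for `p ≥ 1` the trivial
  -- decomposition of `ρ` suffices.
  obtain hp1 | hp1 := le_total 1 p
  · refine (convexRoof_le_self _ hρ).trans ((hR' ρ hρ).trans ?_)
    exact le_mul_of_one_le_right' (ENNReal.one_le_ofReal.mpr hp1)
  obtain hp0 | hp0 := hp.eq_or_lt
  · subst hp0
    -- A positive matrix of trace `0` vanishes, so `ρ = σ`.
    rw [Complex.ofReal_zero, h.trace_eq_zero_iff, sub_zero, one_smul, sub_eq_zero] at htr
    subst htr
    refine (convexRoof_le_self _ hρ).trans ?_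
    rw [G.cost_eq_zero hσ]
    simp
  · have hτ : IsDensity (p⁻¹ • (ρ - (1 - p) • σ)) := by
      refine ⟨h.smul (inv_nonneg.mpr hp), ?_⟩
      rw [trace_smul, htr, Complex.real_smul, ← Complex.ofReal_mul, inv_mul_cancel₀ hp0.ne',
        Complex.ofReal_one]
    refine (convexRoof_le_of_eq_add _ hσd hτ hp hp1 ?_).trans ?_
    · rw [smul_inv_smul₀ hp0.ne', add_sub_cancel]
    · rw [G.cost_eq_zero hσ, mul_comm (R : ℝ≥0∞)]
      simpa using mul_le_mul_right (hR' _ hτ) (ENNReal.ofReal p)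

theorem QNetwork.convexRoof_cost_le {next : MultiState V → MultiState V → Prop} {R : ℕ∞}
    (hR : ∀ τ : Matrix (∀ v, a v) (∀ v, a v) ℂ, IsDensity τ → G.cost next τ ≤ R)
    (hρ : IsDensity ρ) : convexRoof (G.cost next) ρ ≤ (R : ℝ≥0∞) * G.weight ρ := by
  -- When `R = ⊤` the right side is `⊤ * 0 = 0`, so `ρ` must be shown to be free itself; here
  -- closedness of `freeStates` enters.
  by_cases hw : G.weight ρ = 0
  · refine (convexRoof_le_self _ hρ).trans ?_
    rw [G.cost_eq_zero (G.mem_freeStates_of_weight_eq_zero hρ hw)]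
    simp
  by_cases htop : R = ⊤
  · rw [htop, ENat.toENNReal_top, ENNReal.top_mul hw]
    exact le_top
  have htop' : (R : ℝ≥0∞) ≠ ⊤ := by simpa using htop
  -- Dividing by `R` isolates the infimum; `R = 0` is admissible because the weight is finite.
  rw [mul_comm, ← ENNReal.div_le_iff_le_mul (Or.inr (G.weight_ne_top hρ)) (Or.inl htop')]
  refine le_iInf fun p => le_iInf₂ fun σ hσ => le_iInf fun h => ?_
  rw [ENNReal.div_le_iff_le_mul (Or.inr ENNReal.ofReal_ne_top) (Or.inl htop'), mul_comm]
  exact G.convexRoof_cost_le_mul hR hρ hσ h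

end Weight

end

theorem mainTheorem2 {V : Type*} [Fintype V] [DecidableEq V] (G : QNetwork V)
    {a : V → Type} [∀ v, Fintype (a v)] [∀ v, DecidableEq (a v)]
    (ρ : Matrix (∀ v, a v) (∀ v, a v) ℂ) (hρ : IsDensity ρ) :
    (G.weight ρ ≤ G.commCost ρ ∧
      G.commCost ρ ≤ (G.edgeRadius : ℝ≥0∞) * G.weight ρ) ∧
    (G.weight ρ ≤ G.roundComplexity ρ ∧
      G.roundComplexity ρ ≤ (G.connDomNumber : ℝ≥0∞) * G.weight ρ) := by
  exact ⟨⟨G.weight_le_convexRoof _ hρ, G.convexRoof_cost_le (fun _ h => G.cost_isStep_le h) hρ⟩,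
    G.weight_le_convexRoof _ hρ, G.convexRoof_cost_le (fun _ h => G.cost_isRound_le h) hρ⟩
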